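/- Fix $\sigma\ge 1$ and $C_0\ge 0$. Let $G^\sigma(\mathbf R^2)$ be the Gevrey class: all $a\in C^\infty(\mathbf R^2)$ such that for every compact $K\subset\mathbf R^2$ there is $C>0$ with $|\partial_\xi^i\partial_\eta^j a|\le C^{i+j+1}(i!\,j!)^\sigma$ on $K$ for all $i,j\ge 0$. For a weight $m$ put $$R_m[f](\xi,\eta)=\int_{\mathbf R} f(x,\xi x+\eta)\,m(x,\xi,\eta)\,dx .$$ Let $\|\cdot\|_{\varepsilon,\gamma}$ ($0<\varepsilon,\gamma<1$) be any $[0,\infty]$-valued size of functions $g(\xi,\eta)$ for which there is $c>0$, independent of $\varepsilon,\gamma,g$, such that for every continuous $g$ $$\|g\|_{\varepsilon,\gamma}\ \ge\ c\,\max\Big\{\int_{|\xi|\le\varepsilon}\int_{|\eta|<\gamma}|g|\,d\eta\,d\xi,\ \int_{-\varepsilon}^{\varepsilon}|g(\xi,\gamma)|\,d\xi\Big\};$$ an example is $\sup_{|\eta|\le\gamma}\|g(\cdot,\eta)\|_{L^1[-\varepsilon,\varepsilon]}$. Theorem. There is a constant $M>0$, depending only on $C_0$ and $\sigma$, such that the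 following holds for every $0<\alpha\le1$, all complex-valued $a,b\in G^\sigma(\mathbf R^2)$ and every complex-valued $m\in C^\infty(\mathbf R^3)$ satisfying $$\partial_\xi m(x,\xi,\eta)-x\,\partial_\eta m(x,\xi,\eta)=(x\,a(\xi,\eta)+b(\xi,\eta))\,m(x,\xi,\eta)\quad\text{on }\mathbf R^3 .$$ For every size $\|\cdot\|_{\varepsilon,\gamma}$ as above and all $0<\varepsilon,\gamma<1$ there is $\delta>0$ such that every $f:\mathbf R^2\to\mathbf C$ with $|f(\mathbf x)-f(\mathbf y)|\le C_0\|\mathbf x-\mathbf y\|^\alpha$ for all $\mathbf x,\mathbf y\in\mathbf R^2$ and $\operatorname{supp} f\subset\{(x,y):y\ge x^2\}$ satisfies: (i) if $0<\|R_m[f]\|_{\varepsilon,\gamma}<\delta$, then $$\|f(\cdot,\gamma)\,m(\cdot,0,\gamma)\|_{L^2(\mathbf R)}\le M\left(\frac{\big(\log\log(\|R_m[f]\|_{\varepsilon,\gamma}^{-1})\big)^2}{\log(\|R_m[f]\|_{\varepsilon,\gamma}^{-1})}\right)^{\alpha};$$ (ii) if $\|R_m[f]\|_{\varepsilon,\gamma}=0$,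 then $\|f(\cdot,\gamma)\,m(\cdot,0,\gamma)\|_{L^2(\mathbf R)}=0$. Consequently, if moreover $m$ is nowhere zero (in particular if $m>0$), then for every such $f$ for which $R_m[f]=0$ in a neighbourhood of the origin of the $(\xi,\eta)$-plane, $f=0$ in a neighbourhood of the origin of the $(x,y)$-plane. -/

import Mathlib

open MeasureTheory
open scoped NNReal ENNReal ContDiff Nat

/-- The Gevrey class `G^σ(ℝ²)`: smooth functions of two real variables such that on every compact
set `|∂_ξ^i ∂_η^j a| ≤ C^(i+j+1) (i! j!)^σ` for all `i, j`, with one constant `C`. -/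
def IsGevrey (σ : ℝ) (a : ℝ → ℝ → ℂ) : Prop :=
  ContDiff ℝ ∞ (fun p : ℝ × ℝ => a p.1 p.2) ∧
    ∀ K : Set (ℝ × ℝ), IsCompact K → ∃ C : ℝ, 0 < C ∧ ∀ i j : ℕ, ∀ p ∈ K,
      ‖iteratedDeriv i (fun ξ : ℝ => iteratedDeriv j (fun η : ℝ => a ξ η) p.2) p.1‖
        ≤ C ^ (i + j + 1) * (((i ! * j ! : ℕ) : ℝ)) ^ σ

/-- A smooth weight `m(x, ξ, η)` on `ℝ³`
with `∂_ξ m - x ∂_η m = (x a(ξ, η) + b(ξ, η)) m` everywhere. -/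
structure IsWeight (a b : ℝ → ℝ → ℂ) (m : ℝ → ℝ → ℝ → ℂ) : Prop where
  smooth : ContDiff ℝ ∞ (fun p : ℝ × ℝ × ℝ => m p.1 p.2.1 p.2.2)
  equation : ∀ x ξ η : ℝ,
    deriv (fun t : ℝ => m x t η) ξ - (x : ℂ) * deriv (fun t : ℝ => m x ξ t) η
      = ((x : ℂ) * a ξ η + b ξ η) * m x ξ η

/-- The weighted Radon transform `R_m[f](ξ, η) = ∫ f(x, ξ x + η) m(x, ξ, η) dx`. -/
noncomputable def weightedRadon (m : ℝ → ℝ → ℝ → ℂ) (f : EuclideanSpace ℝ (Fin 2) → ℂ)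
    (ξ η : ℝ) : ℂ :=
  ∫ x : ℝ, f !₂[x, ξ * x + η] * m x ξ η

/-- The `L¹` norm of `g(ξ, η)` over the rectangle `|ξ| ≤ ε`, `|η| < γ`. -/
noncomputable def rectL1 (ε γ : ℝ) (g : ℝ → ℝ → ℂ) : ℝ≥0∞ :=
  ∫⁻ p in Set.Icc (-ε) ε ×ˢ Set.Ioo (-γ) γ, ‖g p.1 p.2‖ₑ

/-- The `L¹` norm of `g(·, η)` over `[-ε, ε]`. -/
noncomputable def lineL1 (ε η : ℝ) (g : ℝ → ℝ → ℂ) : ℝ≥0∞ :=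
  ∫⁻ ξ in Set.Icc (-ε) ε, ‖g ξ η‖ₑ

/-- `N ε γ g` is a way to measure the size `‖g‖_{ε,γ}` of the data `g` which controls, up to an
absolute constant, both the `L¹` norm over the rectangle and the `L¹` norm on the line `η = γ`.
The norm axioms and the monotonicity in `ε, γ` are not required. -/
def ControlsData (N : ℝ → ℝ → (ℝ → ℝ → ℂ) → ℝ≥0∞) : Prop :=
  ∃ c : ℝ≥0, 0 < c ∧ ∀ ε γ : ℝ, 0 < ε → ε < 1 → 0 < γ → γ < 1 →
    ∀ g : ℝ → ℝ → ℂ, Continuous (fun p : ℝ × ℝ => g p.1 p.2) →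
      (c : ℝ≥0∞) * max (rectL1 ε γ g) (lineL1 ε γ g) ≤ N ε γ g

/-- The standard example `sup_{|η| ≤ γ} ‖g(·, η)‖_{L¹[-ε, ε]}`. -/
noncomputable def supLineNorm (ε γ : ℝ) (g : ℝ → ℝ → ℂ) : ℝ≥0∞ :=
  ⨆ η ∈ Set.Icc (-γ) γ, lineL1 ε η g

theorem controlsData_supLineNorm : ControlsData supLineNorm := by
  refine ⟨1 / 2, by norm_num, fun ε γ _ _ hγ hγ1 g hg => ?_⟩
  have hline : lineL1 ε γ g ≤ supLineNorm ε γ g :=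
    le_iSup₂_of_le (f := fun η (_ : η ∈ Set.Icc (-γ) γ) => lineL1 ε η g) γ
      ⟨by linarith, le_rfl⟩ le_rfl
  have hrect : rectL1 ε γ g ≤ supLineNorm ε γ g * 2 := by
    unfold rectL1
    rw [Measure.volume_eq_prod, ← Measure.prod_restrict,
      lintegral_prod_symm _ (by exact hg.enorm.measurable.aemeasurable)]
    calc ∫⁻ η in Set.Ioo (-γ) γ, ∫⁻ ξ in Set.Icc (-ε) ε, ‖g ξ η‖ₑ
        ≤ ∫⁻ _ in Set.Ioo (-γ) γ, supLineNorm ε γ g :=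
          setLIntegral_mono' measurableSet_Ioo fun η hη =>
            le_iSup₂_of_le (f := fun η (_ : η ∈ Set.Icc (-γ) γ) => lineL1 ε η g) η
              ⟨hη.1.le, hη.2.le⟩ le_rfl
      _ = supLineNorm ε γ g * ENNReal.ofReal (γ - -γ) := by
          rw [setLIntegral_const, Real.volume_Ioo]
      _ ≤ supLineNorm ε γ g * 2 := by
          gcongr
          exact ENNReal.ofReal_le_of_le_toReal (by simp; linarith)
  have hmax : max (rectL1 ε γ g) (lineL1 ε γ g) ≤ 2 * supLineNorm ε γ g := by
    refine max_le (by rwa [mul_comm]) (hline.trans ?_)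
    rw [two_mul]
    exact le_self_add
  calc ((1 / 2 : ℝ≥0) : ℝ≥0∞) * max (rectL1 ε γ g) (lineL1 ε γ g)
      ≤ ((1 / 2 : ℝ≥0) : ℝ≥0∞) * (2 * supLineNorm ε γ g) := by gcongr
    _ = supLineNorm ε γ g := by
        rw [← mul_assoc]
        have : ((1 / 2 : ℝ≥0) : ℝ≥0∞) * 2 = 1 := by
          rw [show (2 : ℝ≥0∞) = ((2 : ℝ≥0) : ℝ≥0∞) from rfl, ← ENNReal.coe_mul]
          norm_num
        rw [this, one_mul]

/-! Fix a point `(x, y)` and move along the lines `η = y - ξ x` through it. There the weight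
equation is an ordinary differential equation in `ξ` with coefficient `x a + b`. The gauge `E = exp
(∫_γ^η a)` trades the term `x a` for `∫_γ^η ∂_ξ a`, so `w = m E` satisfies the equation with
coefficient `β = b + ∫_γ^η ∂_ξ a`, free of `x` (`IsWeight.hasDerivAt_gauge`).

Now average `u(x, ξ x + η) w(x, ξ, η)` against a test function `ψ(ξ, η)`. Integrating by parts along
these lines, multiplication of the average by `x` amounts to replacing `ψ` by `Tψ = (∂_ξ + β) ∫_γ^η
ψ` (`mul_sliceAvg`). Hence the `k`-th moment in `x` of the average is the integral of the data
against `E T^k ψ` (`pow_mul_sliceAvg`, `enorm_integral_sliceAvg_le`): finitely many moments are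
controlled by the data on a small rectangle. The support condition makes all of this compact and
confines `η` to `(-γ, γ)`.

Take for `ψ` a bump of unit mass and width `h = 1/n` at `(0, γ)`, flat to order `2n` at `ξ = ±h`. By
Hölder continuity its average is within `O(n^(-α))` of `g(x) = u(x, γ) m(x, 0, γ)`. For `k < n` the
Gevrey bounds give `|T^k ψ| ≤ n^(O(n))` (`norm_jetStep_iterate_le`, `exists_gauge_bounds`).
Conversely, `n` moments of a function on `[-2, 2]` determine its Fourier transform at frequencies up
to a multiple of `n`, with exponentially small error, and a band-limited mollifier then recovers `g`
up to `n^(-α)` (`exists_norm_le_of_moments`). Altogether `|g| ≤ A n^(-α) + n^(P n) r` for data of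
size `r` (`exists_stability_estimate`).

With `L = log (1/r)` and `n` of order `L / (log L)^2`, the factor `n^(P n)` is at most `exp (L/2)`,
and the first term yields the stated rate. For `r = 0`, let `n → ∞`. -/

/-! ### Calculus along lines, and jets in the variable `ξ` -/

/-- The chain rule along the lines `η = y - ξ x`, for a function with continuous partial
derivatives. -/
theorem hasDerivAt_along_line {g g₁ g₂ : ℝ → ℝ → ℂ}
    (hg₁ : Continuous fun p : ℝ × ℝ => g₁ p.1 p.2) (hg₂ : Continuous fun p : ℝ × ℝ => g₂ p.1 p.2)
    (h₁ : ∀ ξ η, HasDerivAt (fun t => g t η) (g₁ ξ η) ξ)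
    (h₂ : ∀ ξ η, HasDerivAt (fun t => g ξ t) (g₂ ξ η) η) (x y ξ : ℝ) :
    HasDerivAt (fun t => g t (y - t * x)) (g₁ ξ (y - ξ * x) - x * g₂ ξ (y - ξ * x)) ξ := by
  have key := hasStrictFDerivAt_uncurry_coprod (𝕜 := ℝ) (u := (ξ, y - ξ * x)) (f := g)
    (f₁ := fun a b => (ContinuousLinearMap.toSpanSingleton ℝ (g₁ a b)))
    (f₂ := fun a b => (ContinuousLinearMap.toSpanSingleton ℝ (g₂ a b)))
    (.of_forall fun v => (h₁ v.1 v.2).hasFDerivAt) (.of_forall fun v => (h₂ v.1 v.2).hasFDerivAt)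
    ((ContinuousLinearMap.toSpanSingletonCLE (𝕜 := ℝ) (E := ℂ)).continuous.comp hg₁).continuousAt
    ((ContinuousLinearMap.toSpanSingletonCLE (𝕜 := ℝ) (E := ℂ)).continuous.comp hg₂).continuousAt
  have hc : HasDerivAt (fun t : ℝ => (t, y - t * x)) ((1 : ℝ), -x) ξ := by
    refine (hasDerivAt_id ξ).prodMk ?_
    simpa using ((hasDerivAt_id ξ).mul_const x).const_sub y
  have := key.hasFDerivAt.comp_hasDerivAt ξ hc
  refine this.congr_deriv ?_
  simp [Function.HasUncurry.uncurry, sub_eq_add_neg]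

/-- Differentiation under an integral over a compact interval, for jointly continuous data. -/
theorem hasDerivAt_intervalIntegral_of_continuous {F F' : ℝ → ℝ → ℂ}
    (hF : Continuous fun p : ℝ × ℝ => F p.1 p.2) (hF' : Continuous fun p : ℝ × ℝ => F' p.1 p.2)
    (hd : ∀ ξ s, HasDerivAt (fun t => F t s) (F' ξ s) ξ) (a b ξ : ℝ) :
    HasDerivAt (fun t => ∫ s in a..b, F t s) (∫ s in a..b, F' ξ s) ξ := by
  obtain ⟨B, hB⟩ := ((isCompact_Icc (a := ξ - 1) (b := ξ + 1)).prod
    (isCompact_uIcc (a := a) (b := b))).exists_bound_of_continuousOn hF'.continuousOn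
  have hs : Set.Icc (ξ - 1) (ξ + 1) ∈ nhds ξ := Icc_mem_nhds (by linarith) (by linarith)
  have hFc : ∀ t, Continuous (F t) := fun t => hF.comp (by fun_prop : Continuous fun s => (t, s))
  have hFc' : ∀ t, Continuous (F' t) := fun t => hF'.comp (by fun_prop : Continuous fun s => (t, s))
  refine (intervalIntegral.hasDerivAt_integral_of_dominated_loc_of_deriv_le (μ := volume)
    (bound := fun _ => B) hs (.of_forall fun t => (hFc t).aestronglyMeasurable)
    ((hFc ξ).intervalIntegrable _ _) (hFc' ξ).aestronglyMeasurable
    (.of_forall fun s hs t ht => hB (t, s) ⟨ht, Set.uIoc_subset_uIcc hs⟩)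
    intervalIntegrable_const (.of_forall fun s _ t _ => hd t s)).2

/-- `F i` is the `i`-th derivative in the first variable of a function of two variables, all of
them being jointly continuous. -/
structure IsJet (F : ℕ → ℝ → ℝ → ℂ) : Prop where
  continuous : ∀ i, Continuous fun p : ℝ × ℝ => F i p.1 p.2
  hasDerivAt : ∀ i ξ η, HasDerivAt (fun t => F i t η) (F (i + 1) ξ η) ξ

/-- The derivatives of a product, by the Leibniz rule. -/
def jetMul (F G : ℕ → ℝ → ℝ → ℂ) (i : ℕ) (ξ η : ℝ) : ℂ :=
  ∑ p ∈ Finset.HasAntidiagonal.antidiagonal i, (i.choose p.1 : ℂ) * (F p.1 ξ η * G p.2 ξ η)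

/-- The derivatives of the primitive in the second variable with base point `γ`. -/
noncomputable def jetInt (γ : ℝ) (F : ℕ → ℝ → ℝ → ℂ) (i : ℕ) (ξ η : ℝ) : ℂ :=
  ∫ s in γ..η, F i ξ s

theorem IsJet.mul {F G : ℕ → ℝ → ℝ → ℂ} (hF : IsJet F) (hG : IsJet G) : IsJet (jetMul F G) where
  continuous i := continuous_finsetSum _ fun p _ =>
    continuous_const.mul ((hF.continuous _).mul (hG.continuous _))
  hasDerivAt i ξ η := by
    have := HasDerivAt.fun_sum (u := Finset.HasAntidiagonal.antidiagonal i) fun p _ =>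
      ((hF.hasDerivAt p.1 ξ η).mul (hG.hasDerivAt p.2 ξ η)).const_mul (i.choose p.1 : ℂ)
    refine this.congr_deriv ?_
    have h := Finset.sum_antidiagonal_choose_succ_mul
      (fun k l => F k ξ η * G l ξ η) i
    unfold jetMul
    rw [h, add_comm, ← Finset.sum_add_distrib]
    refine Finset.sum_congr rfl fun p hp => ?_
    rw [Nat.choose_symm_of_eq_add (Finset.HasAntidiagonal.mem_antidiagonal.mp hp).symm]
    ring

theorem IsJet.add {F G : ℕ → ℝ → ℝ → ℂ} (hF : IsJet F) (hG : IsJet G) :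
    IsJet (fun i ξ η => F i ξ η + G i ξ η) where
  continuous i := (hF.continuous i).add (hG.continuous i)
  hasDerivAt i ξ η := (hF.hasDerivAt i ξ η).add (hG.hasDerivAt i ξ η)

theorem IsJet.shift {F : ℕ → ℝ → ℝ → ℂ} (hF : IsJet F) : IsJet (fun i => F (i + 1)) where
  continuous i := hF.continuous (i + 1)
  hasDerivAt i := hF.hasDerivAt (i + 1)

theorem IsJet.continuous_right {F : ℕ → ℝ → ℝ → ℂ} (hF : IsJet F) (i : ℕ) (ξ : ℝ) :
    Continuous (F i ξ) :=
  (hF.continuous i).comp (by fun_prop : Continuous fun s => (ξ, s))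

theorem IsJet.int {F : ℕ → ℝ → ℝ → ℂ} (hF : IsJet F) (γ : ℝ) : IsJet (jetInt γ F) where
  continuous i := by
    have := hF.continuous i
    exact intervalIntegral.continuous_parametric_intervalIntegral_of_continuous
      (f := fun (p : ℝ × ℝ) s => F i p.1 s) (μ := volume) (a₀ := γ) (s := fun p => p.2)
      (this.comp (by fun_prop : Continuous fun q : (ℝ × ℝ) × ℝ => (q.1.1, q.2))) (by fun_prop)
  hasDerivAt i ξ η := hasDerivAt_intervalIntegral_of_continuous (hF.continuous i)
    (hF.continuous (i + 1)) (hF.hasDerivAt i) γ η ξ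

theorem IsJet.hasDerivAt_int {F : ℕ → ℝ → ℝ → ℂ} (hF : IsJet F) (γ : ℝ) (i : ℕ) (ξ η : ℝ) :
    HasDerivAt (fun t => jetInt γ F i ξ t) (F i ξ η) η :=
  intervalIntegral.integral_hasDerivAt_right ((hF.continuous_right i ξ).intervalIntegrable _ _)
    ((hF.continuous_right i ξ).stronglyMeasurableAtFilter _ _)
    (hF.continuous_right i ξ).continuousAt

/-! ### The operator `(∂_ξ + β) ∫_γ^η` and the growth of its iterates -/

/-- The operator `ψ ↦ (∂_ξ + β) ∫_γ^η ψ` on jets. -/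
noncomputable def jetStep (γ : ℝ) (β F : ℕ → ℝ → ℝ → ℂ) (i : ℕ) (ξ η : ℝ) : ℂ :=
  jetInt γ F (i + 1) ξ η + jetMul β (jetInt γ F) i ξ η

theorem IsJet.step {β F : ℕ → ℝ → ℝ → ℂ} (hβ : IsJet β) (hF : IsJet F) (γ : ℝ) :
    IsJet (jetStep γ β F) :=
  (hF.int γ).shift.add (hβ.mul (hF.int γ))

/-- The Leibniz coefficients are binomial, so geometric bounds of ratios `a` and `b` combine, by the
binomial theorem, into one of ratio `a + b`. -/
theorem norm_jetMul_le {F G : ℕ → ℝ → ℝ → ℂ} {P Q a b ξ η : ℝ} {i : ℕ} (hP : 0 ≤ P) (ha : 0 ≤ a)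
    (hF : ∀ l ≤ i, ‖F l ξ η‖ ≤ P * a ^ l) (hG : ∀ l ≤ i, ‖G l ξ η‖ ≤ Q * b ^ l) :
    ‖jetMul F G i ξ η‖ ≤ P * Q * (a + b) ^ i := by
  rw [(Commute.all a b).add_pow', Finset.mul_sum]
  refine norm_sum_le_of_le _ fun p hp => ?_
  have h := Finset.HasAntidiagonal.mem_antidiagonal.mp hp
  rw [norm_mul, norm_mul, Complex.norm_natCast, nsmul_eq_mul]
  calc (i.choose p.1 : ℝ) * (‖F p.1 ξ η‖ * ‖G p.2 ξ η‖)
      ≤ (i.choose p.1 : ℝ) * ((P * a ^ p.1) * (Q * b ^ p.2)) := by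
        gcongr
        · exact hF _ (by omega)
        · exact hG _ (by omega)
    _ = _ := by ring

theorem jetMul_eq_zero {F G : ℕ → ℝ → ℝ → ℂ} {ξ η : ℝ} {i : ℕ} (hG : ∀ l ≤ i, G l ξ η = 0) :
    jetMul F G i ξ η = 0 :=
  Finset.sum_eq_zero fun p hp => by
    rw [hG p.2 (by have := Finset.HasAntidiagonal.mem_antidiagonal.mp hp; omega)]; simp

theorem jetMul_eq_zero_left {F G : ℕ → ℝ → ℝ → ℂ} {ξ η : ℝ} {i : ℕ}
    (hF : ∀ l ≤ i, F l ξ η = 0) : jetMul F G i ξ η = 0 :=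
  Finset.sum_eq_zero fun p hp => by
    rw [hF p.1 (by have := Finset.HasAntidiagonal.mem_antidiagonal.mp hp; omega)]; simp

/-- Each application of the operator differentiates once in `ξ` and so uses up one order of
vanishing at an endpoint. This is why the bump is made flat to high order there. -/
theorem jetStep_eq_zero_of_endpoint {β F : ℕ → ℝ → ℝ → ℂ} {γ ξ η : ℝ} {i : ℕ}
    (hF : ∀ l ≤ i + 1, ∀ s, F l ξ s = 0) : jetStep γ β F i ξ η = 0 := by
  have h : ∀ l ≤ i + 1, jetInt γ F l ξ η = 0 := fun l hl => by
    simp [jetInt, hF l hl]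
  rw [jetStep, h _ le_rfl, jetMul_eq_zero fun l hl => h l (by omega), add_zero]

/-- Taking `γ` as base point of the primitive keeps the support in `η ≤ γ` without any mean-zero
condition on the test function. -/
theorem jetInt_eq_zero_of_ge {F : ℕ → ℝ → ℝ → ℂ} {γ : ℝ}
    (hF : ∀ i ξ η, γ ≤ η → F i ξ η = 0) (i : ℕ) (ξ η : ℝ) (hη : γ ≤ η) :
    jetInt γ F i ξ η = 0 := by
  unfold jetInt
  rw [intervalIntegral.integral_congr (g := fun _ => 0), intervalIntegral.integral_zero]
  intro s hs
  rw [Set.uIcc_of_le hη] at hs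
  exact hF i ξ s hs.1

theorem jetStep_eq_zero_of_ge {β F : ℕ → ℝ → ℝ → ℂ} {γ : ℝ}
    (hF : ∀ i ξ η, γ ≤ η → F i ξ η = 0) (i : ℕ) (ξ η : ℝ) (hη : γ ≤ η) :
    jetStep γ β F i ξ η = 0 := by
  rw [jetStep, jetInt_eq_zero_of_ge hF _ _ _ hη,
    jetMul_eq_zero fun l _ => jetInt_eq_zero_of_ge hF l ξ η hη, add_zero]

theorem norm_jetInt_le {F : ℕ → ℝ → ℝ → ℂ} {γ Q ξ η : ℝ} {i : ℕ} (hγ : γ ≤ 1)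
    (hF : ∀ s ∈ Set.Icc (-γ) γ, ‖F i ξ s‖ ≤ Q) (hη : η ∈ Set.Icc (-γ) γ) :
    ‖jetInt γ F i ξ η‖ ≤ 2 * Q := by
  have hQ : 0 ≤ Q := (norm_nonneg _).trans (hF η hη)
  have h := intervalIntegral.norm_integral_le_of_norm_le_const (a := γ) (b := η) (C := Q)
    (f := F i ξ) fun s hs => hF s (by
      rw [Set.uIoc_of_ge hη.2] at hs
      exact ⟨hη.1.trans hs.1.le, hs.2⟩)
  have h2 : |η - γ| ≤ 2 := by rw [abs_le]; constructor <;> linarith [hη.1, hη.2]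
  calc _ ≤ Q * |η - γ| := h
    _ ≤ Q * 2 := by gcongr
    _ = _ := mul_comm _ _

/-- Bounds for the iterates of `jetStep`. -/
theorem norm_jetStep_iterate_le {β F : ℕ → ℝ → ℝ → ℂ} {γ D l₀ Λ Q : ℝ} {n : ℕ} {S : Set ℝ}
    (hγ : γ ≤ 1) (hD : 0 ≤ D) (hl : 0 ≤ l₀) (hΛ : 0 ≤ Λ) (hQ : 0 ≤ Q)
    (hβ : ∀ i ≤ n, ∀ ξ ∈ S, ∀ η ∈ Set.Icc (-γ) γ, ‖β i ξ η‖ ≤ D * l₀ ^ i)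
    (hF : ∀ i ≤ n, ∀ ξ ∈ S, ∀ η ∈ Set.Icc (-γ) γ, ‖F i ξ η‖ ≤ Q * Λ ^ i) :
    ∀ j i, i + j ≤ n → ∀ ξ ∈ S, ∀ η ∈ Set.Icc (-γ) γ,
      ‖(jetStep γ β)^[j] F i ξ η‖
        ≤ Q * (2 * (Λ + n * l₀ + D)) ^ j * (Λ + j * l₀) ^ i := by
  intro j
  induction j with
  | zero =>
    intro i hi ξ hξ η hη
    simpa using hF i (by omega) ξ hξ η hη
  | succ j ih =>
    intro i hi ξ hξ η hη
    rw [Function.iterate_succ_apply', jetStep]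
    set G := (jetStep γ β)^[j] F
    set Qj := Q * (2 * (Λ + n * l₀ + D)) ^ j with hQj
    set Λj := Λ + j * l₀ with hΛj
    have hQj0 : 0 ≤ Qj := by positivity
    have hΛj0 : 0 ≤ Λj := by positivity
    have hint : ∀ l ≤ i + 1, ‖jetInt γ G l ξ η‖ ≤ 2 * Qj * Λj ^ l := fun l hl => by
      have := norm_jetInt_le (F := G) (i := l) hγ
        (fun s hs => ih l (by omega) ξ hξ s hs) hη
      rwa [← mul_assoc] at this
    have h1 := hint (i + 1) le_rfl
    have h2 := norm_jetMul_le (F := β) (G := jetInt γ G) (i := i) hD hl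
      (fun l hl => hβ l (by omega) ξ hξ η hη) (fun l hl => hint l (by omega))
    have hjn : (j : ℝ) ≤ n := by exact_mod_cast (by omega : j ≤ n)
    have hle : Λj ≤ Λ + n * l₀ := by rw [hΛj]; gcongr
    have hΛs : l₀ + Λj = Λ + (j + 1 : ℕ) * l₀ := by rw [hΛj]; push_cast; ring
    have hpow : Λj ^ i ≤ (l₀ + Λj) ^ i := by gcongr; linarith
    -- Integration in `η` costs a factor 2. The derivative costs a further `Λj`, bounded uniformly
    -- in `j` by `Λ + n l₀`; multiplication by `β` costs `D` and raises the ratio by `l₀`.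
    calc _ ≤ ‖jetInt γ G (i + 1) ξ η‖ + ‖jetMul β (jetInt γ G) i ξ η‖ := norm_add_le _ _
      _ ≤ 2 * Qj * Λj ^ (i + 1) + D * (2 * Qj) * (l₀ + Λj) ^ i := add_le_add h1 h2
      _ = 2 * Qj * Λj * Λj ^ i + D * (2 * Qj) * (l₀ + Λj) ^ i := by ring
      _ ≤ 2 * Qj * (Λ + n * l₀) * (l₀ + Λj) ^ i + D * (2 * Qj) * (l₀ + Λj) ^ i := by gcongr
      _ = Qj * (2 * (Λ + n * l₀ + D)) * (l₀ + Λj) ^ i := by ring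
      _ = _ := by rw [hQj, hΛs, pow_succ]; ring

/-- The derivatives of `(ξ - c) ^ N`. -/
noncomputable def powJet (c : ℝ) (N : ℕ) (i : ℕ) (ξ _η : ℝ) : ℂ :=
  (((N.descFactorial i : ℝ) * (ξ - c) ^ (N - i) : ℝ) : ℂ)

theorem isJet_powJet (c : ℝ) (N : ℕ) : IsJet (powJet c N) where
  continuous i := by unfold powJet; fun_prop
  hasDerivAt i ξ η := by
    have h := ((((hasDerivAt_id ξ).sub_const c).pow (N - i)).const_mul
      (N.descFactorial i : ℝ)).ofReal_comp
    refine h.congr_deriv ?_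
    simp only [powJet, id, Nat.descFactorial_succ, Nat.sub_sub]
    push_cast
    ring

/-- A power of order `N` obeys geometric derivative bounds of ratio `N / (2h)`, with no factorial
growth, as long as at most `N` derivatives are taken. -/
theorem norm_powJet_le {c h ξ : ℝ} (hh : 0 < h) (hc : |c| ≤ h) (hξ : |ξ| ≤ h) {N i : ℕ}
    (hi : i ≤ N) (η : ℝ) : ‖powJet c N i ξ η‖ ≤ (2 * h) ^ N * (N / (2 * h)) ^ i := by
  have h1 : |ξ - c| ≤ 2 * h := (abs_sub _ _).trans (by linarith)
  have h2 : ((N.descFactorial i : ℕ) : ℝ) ≤ (N : ℝ) ^ i := by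
    exact_mod_cast Nat.descFactorial_le_pow N i
  rw [powJet, Complex.norm_real, norm_mul, norm_pow, Real.norm_eq_abs, Real.norm_eq_abs,
    Nat.abs_cast]
  calc _ ≤ (N : ℝ) ^ i * (2 * h) ^ (N - i) := by gcongr
    _ = _ := by
      rw [div_pow, pow_sub₀ _ (by positivity) hi]; ring

theorem powJet_self {c : ℝ} {N i : ℕ} (hi : i < N) (η : ℝ) : powJet c N i c η = 0 := by
  simp [powJet, Nat.sub_ne_zero_of_lt hi]

/-! ### Slice averages and their moments -/

theorem intervalIntegral_swap_of_continuous {F : ℝ → ℝ → ℂ}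
    (hF : Continuous fun p : ℝ × ℝ => F p.1 p.2) (a b c d : ℝ) :
    ∫ x in a..b, ∫ y in c..d, F x y = ∫ y in c..d, ∫ x in a..b, F x y := by
  refine intervalIntegral_intervalIntegral_swap (F := F) ?_
  have : IntegrableOn (fun p : ℝ × ℝ => F p.1 p.2) (Set.uIcc a b ×ˢ Set.uIcc c d) :=
    hF.continuousOn.integrableOn_compact (isCompact_uIcc.prod isCompact_uIcc)
  exact this.mono_set (Set.prod_mono Set.uIoc_subset_uIcc Set.uIoc_subset_uIcc)

theorem intervalIntegral_intervalIntegral_sub {F G : ℝ → ℝ → ℂ}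
    (hF : Continuous fun p : ℝ × ℝ => F p.1 p.2) (hG : Continuous fun p : ℝ × ℝ => G p.1 p.2)
    (a b c d : ℝ) :
    ∫ x in a..b, ∫ y in c..d, (F x y - G x y)
      = (∫ x in a..b, ∫ y in c..d, F x y) - ∫ x in a..b, ∫ y in c..d, G x y := by
  have hr (x : ℝ) : Continuous fun y : ℝ => (x, y) := by fun_prop
  rw [← intervalIntegral.integral_sub
    ((intervalIntegral.continuous_parametric_intervalIntegral_of_continuous'
      (f := F) hF c d).intervalIntegrable _ _)
    ((intervalIntegral.continuous_parametric_intervalIntegral_of_continuous'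
      (f := G) hG c d).intervalIntegrable _ _)]
  exact intervalIntegral.integral_congr fun x _ => intervalIntegral.integral_sub
    ((hF.comp (hr x)).intervalIntegrable _ _) ((hG.comp (hr x)).intervalIntegrable _ _)

/-- The average of `η ↦ u(x, ξ x + η) w(x, ξ, η)` against `ψ(ξ, η)` over `[-h, h] × [-1, 1]`. -/
noncomputable def sliceAvg (u : ℝ → ℝ → ℂ) (w : ℝ → ℝ → ℝ → ℂ) (h : ℝ) (ψ : ℝ → ℝ → ℂ)
    (x : ℝ) : ℂ :=
  ∫ ξ in -h..h, ∫ η in (-1)..1, u x (ξ * x + η) * (w x ξ η * ψ ξ η)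

/-- Integration by parts along the lines through a fixed point: multiplication by `x` is turned
into a differential operator on the test function. -/
theorem mul_sliceAvg {u : ℝ → ℝ → ℂ} {w : ℝ → ℝ → ℝ → ℂ} {β ρ ρ₁ ρ₂ : ℝ → ℝ → ℂ} {h γ x : ℝ}
    (hu : Continuous fun p : ℝ × ℝ => u p.1 p.2) (hsupp : ∀ x y, y < x ^ 2 → u x y = 0)
    (hw : Continuous fun p : ℝ × ℝ × ℝ => w p.1 p.2.1 p.2.2)
    (hβ : Continuous fun p : ℝ × ℝ => β p.1 p.2)
    (hdw : ∀ y ξ, HasDerivAt (fun t => w x t (y - t * x))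
      (β ξ (y - ξ * x) * w x ξ (y - ξ * x)) ξ)
    (hρ : Continuous fun p : ℝ × ℝ => ρ p.1 p.2)
    (hρ₁ : Continuous fun p : ℝ × ℝ => ρ₁ p.1 p.2) (hρ₂ : Continuous fun p : ℝ × ℝ => ρ₂ p.1 p.2)
    (hd₁ : ∀ ξ η, HasDerivAt (fun t => ρ t η) (ρ₁ ξ η) ξ)
    (hd₂ : ∀ ξ η, HasDerivAt (fun t => ρ ξ t) (ρ₂ ξ η) η)
    (hz : ∀ ξ η, γ ≤ η → ρ ξ η = 0) (hz₁ : ∀ ξ η, γ ≤ η → ρ₁ ξ η = 0)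
    (hz₂ : ∀ ξ η, γ ≤ η → ρ₂ ξ η = 0)
    (hl : ∀ η, ρ (-h) η = 0) (hr : ∀ η, ρ h η = 0)
    (h0 : 0 < h) (h1 : h ≤ 1) (hγ : γ < 1) (hx : |x| ≤ 2) :
    x * sliceAvg u w h ρ₂ x = sliceAvg u w h (fun ξ η => β ξ η * ρ ξ η + ρ₁ ξ η) x := by
  obtain ⟨hx1, hx2⟩ := abs_le.mp hx
  set Θ : ℝ → ℝ → ℂ := fun ξ η =>
    w x ξ η * (β ξ η * ρ ξ η + ρ₁ ξ η) - x * (w x ξ η * ρ₂ ξ η) with hΘdef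
  have hwx : Continuous fun p : ℝ × ℝ => w x p.1 p.2 :=
    hw.comp (by fun_prop : Continuous fun p : ℝ × ℝ => (x, p.1, p.2))
  have hΘ : Continuous fun p : ℝ × ℝ => Θ p.1 p.2 := by simp only [hΘdef]; fun_prop
  have hΘz : ∀ ξ η, γ ≤ η → Θ ξ η = 0 := fun ξ η hη => by
    simp [hΘdef, hz ξ η hη, hz₁ ξ η hη, hz₂ ξ η hη]
  have hux : Continuous (u x) := hu.comp (by fun_prop : Continuous fun y => (x, y))
  -- the whole integral of the directional derivative vanishes
  have hzero : ∫ ξ in -h..h, ∫ η in (-1)..1, u x (ξ * x + η) * Θ ξ η = 0 := by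
    have hshift : ∀ ξ ∈ Set.uIcc (-h) h, ∫ η in (-1)..1, u x (ξ * x + η) * Θ ξ η
        = ∫ y in (-4)..4, u x y * Θ ξ (y - ξ * x) := by
      intro ξ hξ
      rw [Set.uIcc_of_le (by linarith)] at hξ
      have hξ1 : |ξ| ≤ 1 := abs_le.mpr ⟨by linarith [hξ.1], by linarith [hξ.2]⟩
      have hξx : |ξ * x| ≤ 2 := by
        rw [abs_mul]; nlinarith [abs_nonneg x, abs_nonneg ξ]
      obtain ⟨hq1, hq2⟩ := abs_le.mp hξx
      have hξ2 : ξ ^ 2 ≤ 1 := by rw [← sq_abs]; nlinarith [abs_nonneg ξ]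
      -- Where the integrand is nonzero, `x² ≤ y = ξ x + η` and `η < γ < 1`; with `|ξ| ≤ 1` and `|x|
      -- ≤ 2` this puts `η` in `(-1, 1)` and `y` in `(-4, 4)`. Both integrals thus run over the
      -- whole line and differ by a translation.
      rw [intervalIntegral.integral_eq_integral_of_support_subset,
        intervalIntegral.integral_eq_integral_of_support_subset]
      · rw [← integral_sub_right_eq_self _ (ξ * x)]
        refine integral_congr_ae (.of_forall fun y => ?_)
        simp
      · intro y hy
        have h1 : u x y ≠ 0 := left_ne_zero_of_mul hy
        have h2 : Θ ξ (y - ξ * x) ≠ 0 := right_ne_zero_of_mul hy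
        have h3 : x ^ 2 ≤ y := not_lt.mp fun h => h1 (hsupp _ _ h)
        have h4 : y - ξ * x < γ := not_le.mp fun h => h2 (hΘz _ _ h)
        exact ⟨by nlinarith, by linarith⟩
      · intro η hy
        have h1 : u x (ξ * x + η) ≠ 0 := left_ne_zero_of_mul hy
        have h2 : Θ ξ η ≠ 0 := right_ne_zero_of_mul hy
        have h3 : x ^ 2 ≤ ξ * x + η := not_lt.mp fun h => h1 (hsupp _ _ h)
        have h4 : η < γ := not_le.mp fun h => h2 (hΘz _ _ h)
        exact ⟨by nlinarith [sq_nonneg (x - ξ / 2)], by linarith⟩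
    -- At fixed `y` the factor `u x y` does not depend on `ξ`, and `Θ` is the derivative of `w ρ`
    -- along the line. The inner integral is a boundary term, which is zero because `ρ` vanishes at
    -- `ξ = ±h`.
    rw [intervalIntegral.integral_congr hshift, intervalIntegral_swap_of_continuous
      (F := fun ξ y => u x y * Θ ξ (y - ξ * x))]
    · rw [intervalIntegral.integral_congr (g := fun _ => 0), intervalIntegral.integral_zero]
      intro y _
      have hd : ∀ ξ, HasDerivAt (fun t => w x t (y - t * x) * ρ t (y - t * x))
          (Θ ξ (y - ξ * x)) ξ := fun ξ => by
        refine ((hdw y ξ).mul (hasDerivAt_along_line hρ₁ hρ₂ hd₁ hd₂ x y ξ)).congr_deriv ?_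
        simp only [hΘdef]
        ring
      have := intervalIntegral.integral_eq_sub_of_hasDerivAt (a := -h) (b := h)
        (fun ξ _ => hd ξ) ((hΘ.comp (by fun_prop :
          Continuous fun ξ => (ξ, y - ξ * x))).intervalIntegrable _ _)
      simp only [intervalIntegral.integral_const_mul, this, hl, hr]
      simp
    · exact (hux.comp continuous_snd).mul (hΘ.comp
        (by fun_prop : Continuous fun p : ℝ × ℝ => (p.1, p.2 - p.1 * x)))
  have hc1 : Continuous fun p : ℝ × ℝ => u x (p.1 * x + p.2) * (w x p.1 p.2 *
      (β p.1 p.2 * ρ p.1 p.2 + ρ₁ p.1 p.2)) := by fun_prop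
  have hc2 : Continuous fun p : ℝ × ℝ => x * (u x (p.1 * x + p.2) * (w x p.1 p.2 *
      ρ₂ p.1 p.2)) := by fun_prop
  have hsplit : ∀ ξ η, u x (ξ * x + η) * Θ ξ η = u x (ξ * x + η) * (w x ξ η *
      (β ξ η * ρ ξ η + ρ₁ ξ η)) - x * (u x (ξ * x + η) * (w x ξ η * ρ₂ ξ η)) := fun ξ η => by
    simp only [hΘdef]; ring
  have hsub := intervalIntegral_intervalIntegral_sub
    (F := fun ξ η => u x (ξ * x + η) * (w x ξ η * (β ξ η * ρ ξ η + ρ₁ ξ η)))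
    (G := fun ξ η => x * (u x (ξ * x + η) * (w x ξ η * ρ₂ ξ η))) hc1 hc2 (-h) h (-1) 1
  simp only [hsplit] at hzero
  simp only [hzero, intervalIntegral.integral_const_mul] at hsub
  exact (sub_eq_zero.mp hsub.symm).symm

theorem IsJet.step_iterate {β F : ℕ → ℝ → ℝ → ℂ} (hβ : IsJet β) (hF : IsJet F) (γ : ℝ) (k : ℕ) :
    IsJet ((jetStep γ β)^[k] F) := by
  induction k with
  | zero => exact hF
  | succ k ih => rw [Function.iterate_succ_apply']; exact hβ.step ih γ

theorem jetStep_iterate_eq_zero_of_ge {β F : ℕ → ℝ → ℝ → ℂ} {γ : ℝ}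
    (hF : ∀ i ξ η, γ ≤ η → F i ξ η = 0) (k : ℕ) :
    ∀ i ξ η, γ ≤ η → (jetStep γ β)^[k] F i ξ η = 0 := by
  induction k with
  | zero => exact hF
  | succ k ih => rw [Function.iterate_succ_apply']; exact jetStep_eq_zero_of_ge ih

theorem jetStep_iterate_eq_zero_of_endpoint {β F : ℕ → ℝ → ℝ → ℂ} {γ ξ : ℝ} {r : ℕ}
    (hF : ∀ i < r, ∀ s, F i ξ s = 0) (k : ℕ) :
    ∀ i, i + k < r → ∀ s, (jetStep γ β)^[k] F i ξ s = 0 := by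
  induction k with
  | zero => exact fun i hi => hF i hi
  | succ k ih =>
    intro i hi s
    rw [Function.iterate_succ_apply']
    exact jetStep_eq_zero_of_endpoint fun l hl s => ih l (by omega) s

/-- Moments of a slice average are slice averages against transformed test functions. -/
theorem pow_mul_sliceAvg {u : ℝ → ℝ → ℂ} {w : ℝ → ℝ → ℝ → ℂ} {β F : ℕ → ℝ → ℝ → ℂ} {h γ x : ℝ}
    {r : ℕ} (hu : Continuous fun p : ℝ × ℝ => u p.1 p.2)
    (hsupp : ∀ x y, y < x ^ 2 → u x y = 0)
    (hw : Continuous fun p : ℝ × ℝ × ℝ => w p.1 p.2.1 p.2.2) (hβ : IsJet β)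
    (hdw : ∀ y ξ, HasDerivAt (fun t => w x t (y - t * x))
      (β 0 ξ (y - ξ * x) * w x ξ (y - ξ * x)) ξ)
    (hF : IsJet F) (hFγ : ∀ i ξ η, γ ≤ η → F i ξ η = 0)
    (hl : ∀ i < r, ∀ η, F i (-h) η = 0) (hr : ∀ i < r, ∀ η, F i h η = 0)
    (h0 : 0 < h) (h1 : h ≤ 1) (hγ : γ < 1) (hx : |x| ≤ 2) (k : ℕ) (hk : k ≤ r) :
    x ^ k * sliceAvg u w h (F 0) x = sliceAvg u w h ((jetStep γ β)^[k] F 0) x := by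
  induction k with
  | zero => simp
  | succ k ih =>
    set G := (jetStep γ β)^[k] F with hG
    have hGj : IsJet G := hβ.step_iterate hF γ k
    have hGγ := jetStep_iterate_eq_zero_of_ge (β := β) hFγ k
    have hGl := jetStep_iterate_eq_zero_of_endpoint (γ := γ) (β := β) hl k
    have hGr := jetStep_iterate_eq_zero_of_endpoint (γ := γ) (β := β) hr k
    have hint := hGj.int γ
    -- Here `ρ = ∫_γ^η G`, so that `∂_η ρ = G`. Its vanishing at `ξ = ±h` requires that `k` steps
    -- have not exhausted the `r` orders of vanishing.
    rw [pow_succ', mul_assoc, ih (by omega), mul_sliceAvg hu hsupp hw (hβ.continuous 0) hdw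
      (hint.continuous 0) (hint.continuous 1) (hGj.continuous 0) (hint.hasDerivAt 0)
      (hGj.hasDerivAt_int γ 0) (jetInt_eq_zero_of_ge hGγ 0) (jetInt_eq_zero_of_ge hGγ 1)
      (hGγ 0) (fun η => by simp [jetInt, G, hGl 0 (by omega)])
      (fun η => by simp [jetInt, G, hGr 0 (by omega)]) h0 h1 hγ hx]
    rw [Function.iterate_succ_apply']
    congr 1
    ext ξ η
    simp [jetStep, jetMul, add_comm, hG]

/-- The total integral of a slice average is controlled by the data on a rectangle. -/
theorem enorm_integral_sliceAvg_le {u : ℝ → ℝ → ℂ} {m : ℝ → ℝ → ℝ → ℂ} {E ψ R : ℝ → ℝ → ℂ}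
    {h ε γ B : ℝ} (hu : Continuous fun p : ℝ × ℝ => u p.1 p.2)
    (hsupp : ∀ x y, y < x ^ 2 → u x y = 0)
    (hm : Continuous fun p : ℝ × ℝ × ℝ => m p.1 p.2.1 p.2.2)
    (hE : Continuous fun p : ℝ × ℝ => E p.1 p.2) (hψ : Continuous fun p : ℝ × ℝ => ψ p.1 p.2)
    (hR : Continuous fun p : ℝ × ℝ => R p.1 p.2)
    (hRu : ∀ ξ η, R ξ η = ∫ x, u x (ξ * x + η) * m x ξ η)
    (hψγ : ∀ ξ η, γ ≤ η → ψ ξ η = 0)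
    (hB : ∀ ξ ∈ Set.Icc (-h) h, ∀ η ∈ Set.Icc (-γ) γ, ‖E ξ η * ψ ξ η‖ ≤ B)
    (h0 : 0 < h) (hε : h ≤ ε) (hhγ : h ≤ γ) (hγ : γ < 1) :
    ‖∫ x in (-2)..2, sliceAvg u (fun x ξ η => m x ξ η * E ξ η) h ψ x‖ₑ
      ≤ ENNReal.ofReal B * rectL1 ε γ R := by
  have hc : Continuous fun q : ℝ × ℝ × ℝ => u q.1 (q.2.1 * q.1 + q.2.2) *
      (m q.1 q.2.1 q.2.2 * E q.2.1 q.2.2 * ψ q.2.1 q.2.2) :=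
    (hu.comp (by fun_prop : Continuous fun q : ℝ × ℝ × ℝ => (q.1, q.2.1 * q.1 + q.2.2))).mul
      ((hm.mul (hE.comp continuous_snd)).mul (hψ.comp continuous_snd))
  have hswap : ∫ x in (-2)..2, sliceAvg u (fun x ξ η => m x ξ η * E ξ η) h ψ x
      = ∫ ξ in -h..h, ∫ η in (-1)..1, E ξ η * ψ ξ η * R ξ η := by
    unfold sliceAvg
    rw [intervalIntegral_swap_of_continuous (F := fun x ξ => ∫ η in (-1)..1, u x (ξ * x + η) *
      (m x ξ η * E ξ η * ψ ξ η))]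
    · refine intervalIntegral.integral_congr fun ξ hξ => ?_
      rw [Set.uIcc_of_le (by linarith)] at hξ
      rw [intervalIntegral_swap_of_continuous (F := fun x η => u x (ξ * x + η) *
        (m x ξ η * E ξ η * ψ ξ η)) (hc.comp (by fun_prop :
          Continuous fun p : ℝ × ℝ => (p.1, ξ, p.2)))]
      refine intervalIntegral.integral_congr fun η hη => ?_
      rcases le_or_gt γ η with hγη | hγη
      · simp [hψγ ξ η hγη]
      -- For `|ξ| ≤ 1` and `η < 1`, the inequality `x² ≤ ξ x + η` forces `|x| < 2`, so the integral
      -- over `[-2, 2]` is the full transform.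
      · rw [hRu, ← intervalIntegral.integral_eq_integral_of_support_subset (a := -2) (b := 2),
          ← intervalIntegral.integral_const_mul]
        · refine intervalIntegral.integral_congr fun x _ => ?_
          ring
        · intro x hx
          have h2 : u x (ξ * x + η) ≠ 0 := left_ne_zero_of_mul hx
          have h3 : x ^ 2 ≤ ξ * x + η := not_lt.mp fun h => h2 (hsupp _ _ h)
          have hξ1 : -1 ≤ ξ := by linarith [hξ.1]
          have hξ2 : ξ ≤ 1 := by linarith [hξ.2]
          constructor
          · by_contra hcon; nlinarith
          · by_contra hcon; nlinarith
    · exact intervalIntegral.continuous_parametric_intervalIntegral_of_continuous'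
        (f := fun (p : ℝ × ℝ) η => u p.1 (p.2 * p.1 + η) * (m p.1 p.2 η * E p.2 η * ψ p.2 η))
        (hc.comp (by fun_prop : Continuous fun q : (ℝ × ℝ) × ℝ => (q.1.1, q.1.2, q.2))) _ _
  -- These lines stay below the parabola, because `x² - ξ x ≥ -ξ²/4 > -γ`.
  have hRz : ∀ ξ ∈ Set.Icc (-h) h, ∀ η ≤ -γ, R ξ η = 0 := fun ξ hξ η hη => by
    rw [hRu]
    refine integral_eq_zero_of_ae (.of_forall fun x => ?_)
    have hx0 := hsupp x (ξ * x + η) (by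
      have : ξ ^ 2 ≤ h * 1 := by nlinarith [hξ.1, hξ.2]
      nlinarith [sq_nonneg (x - ξ / 2)])
    simp [hx0]
  have hpt : ∀ ξ ∈ Set.Ioc (-h) h, ∀ η, ‖E ξ η * ψ ξ η * R ξ η‖ₑ
      ≤ (Set.Ioo (-γ) γ).indicator (fun η => ENNReal.ofReal B * ‖R ξ η‖ₑ) η := fun ξ hξ η => by
    have hξ' : ξ ∈ Set.Icc (-h) h := ⟨hξ.1.le, hξ.2⟩
    by_cases hη : η ∈ Set.Ioo (-γ) γ
    · rw [Set.indicator_of_mem hη, enorm_mul]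
      gcongr
      rw [← ofReal_norm]
      exact ENNReal.ofReal_le_ofReal (hB ξ hξ' η ⟨hη.1.le, hη.2.le⟩)
    · rw [Set.indicator_of_notMem hη]
      rcases le_or_gt γ η with h2 | h2
      · simp [hψγ ξ η h2]
      · have : η ≤ -γ := not_lt.mp fun h3 => hη ⟨h3, h2⟩
        simp [hRz ξ hξ' η this]
  rw [hswap, intervalIntegral.integral_of_le (by linarith)]
  calc _ ≤ ∫⁻ ξ in Set.Ioc (-h) h, ‖∫ η in (-1)..1, E ξ η * ψ ξ η * R ξ η‖ₑ :=
        enorm_integral_le_lintegral_enorm _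
    _ ≤ ∫⁻ ξ in Set.Ioc (-h) h, ENNReal.ofReal B * ∫⁻ η in Set.Ioo (-γ) γ, ‖R ξ η‖ₑ := by
        refine setLIntegral_mono' measurableSet_Ioc fun ξ hξ => ?_
        rw [intervalIntegral.integral_of_le (by norm_num),
          ← lintegral_const_mul' _ _ ENNReal.ofReal_ne_top, ← lintegral_indicator measurableSet_Ioo]
        refine (enorm_integral_le_lintegral_enorm _).trans ?_
        exact (lintegral_mono fun η => hpt ξ hξ η).trans (setLIntegral_le_lintegral _ _)
    _ ≤ ∫⁻ ξ in Set.Icc (-ε) ε, ENNReal.ofReal B * ∫⁻ η in Set.Ioo (-γ) γ, ‖R ξ η‖ₑ :=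
        lintegral_mono_set fun ξ hξ => ⟨by linarith [hξ.1], hξ.2.trans hε⟩
    _ = _ := by
        rw [lintegral_const_mul' _ _ ENNReal.ofReal_ne_top, rectL1, Measure.volume_eq_prod,
          ← Measure.prod_restrict, lintegral_prod _ (by exact hR.enorm.measurable.aemeasurable)]

/-! ### From small moments to pointwise bounds -/

/-- A band-limited approximate identity: an integrable kernel of integral one with a finite first
absolute moment, whose Fourier transform is supported in `[-1, 1]` and bounded by one. -/
structure IsBandlimitedKernel (K ρ : ℝ → ℂ) : Prop where
  continuous_density : Continuous ρ
  norm_density_le : ∀ t, ‖ρ t‖ ≤ 1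
  continuous : Continuous K
  eq_integral : ∀ z, K z = ∫ t in (-1)..1, Complex.exp (-(2 * Real.pi * t * z * Complex.I)) * ρ t
  integrable : Integrable K
  integrable_moment : Integrable fun z => |z| * ‖K z‖
  integral_eq_one : ∫ z, K z = 1

open FourierTransform in
-- The Fourier transform of a smooth bump supported in `[-1, 1]`: it is a Schwartz function, and
-- Fourier inversion at `0` gives total integral equal to the value 1 of the bump there.
theorem exists_isBandlimitedKernel : ∃ K ρ : ℝ → ℂ, IsBandlimitedKernel K ρ := by
  let f : ContDiffBump (0 : ℝ) := ⟨1 / 2, 1, by norm_num, by norm_num⟩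
  have hsm : ContDiff ℝ ∞ fun t => (f t : ℂ) := Complex.ofRealCLM.contDiff.comp f.contDiff
  have hcs : HasCompactSupport fun t => (f t : ℂ) :=
    f.hasCompactSupport.comp_left (g := fun r : ℝ => (r : ℂ)) (by simp)
  let S : SchwartzMap ℝ ℂ := hcs.toSchwartzMap hsm
  let KS : SchwartzMap ℝ ℂ := 𝓕 S
  have hS : ∀ t, S t = (f t : ℂ) := fun t => rfl
  refine ⟨KS, fun t => (f t : ℂ), hsm.continuous, fun t => ?_, KS.continuous, fun z => ?_,
    KS.integrable, ?_, ?_⟩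
  · rw [Complex.norm_real, Real.norm_eq_abs, abs_of_nonneg f.nonneg]
    exact f.le_one
  · rw [show KS = 𝓕 S from rfl, SchwartzMap.fourier_coe, Real.fourier_real_eq_integral_exp_smul,
      intervalIntegral.integral_eq_integral_of_support_subset]
    · refine integral_congr_ae (.of_forall fun t => ?_)
      simp only [smul_eq_mul, hS]
      congr 2
      push_cast
      ring
    · intro t ht
      have h1 : f t ≠ 0 := fun h => ht (by simp [h])
      have h2 : t ∈ Metric.ball (0 : ℝ) 1 := by
        rw [← f.support_eq]; exact h1
      rw [Real.ball_eq_Ioo] at h2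
      exact ⟨by linarith [h2.1], by linarith [h2.2]⟩
  · simpa using KS.integrable_pow_mul volume 1
  · have h1 : (𝓕⁻ KS : SchwartzMap ℝ ℂ) 0 = 1 := by
      rw [show KS = 𝓕 S from rfl, FourierPair.fourierInv_fourier_eq, hS, f.one_of_mem_closedBall (by simp [f])]
      simp
    rw [SchwartzMap.fourierInv_coe, Real.fourierInv_eq'] at h1
    simpa using h1

theorem integral_scale_comp_sub {E : Type*} [NormedAddCommGroup E] [NormedSpace ℝ E]
    (H : ℝ → E) {T : ℝ} (hT : 0 < T) (x : ℝ) : ∫ y, T • H (T * (x - y)) = ∫ z, H z := by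
  rw [integral_sub_left_eq_self (fun z => T • H (T * z)) volume x, integral_smul,
    Measure.integral_comp_mul_left, smul_smul, abs_of_pos (inv_pos.mpr hT),
    mul_inv_cancel₀ hT.ne', one_smul]

/-- The Fourier transform of a function on `[-2, 2]` at low frequency is controlled by
finitely many moments. -/
theorem norm_integral_exp_mul_le {G : ℝ → ℂ} {B μ s : ℝ} {n : ℕ} (hn : 0 < n) (hG : Continuous G)
    (hGB : ∀ x ∈ Set.Icc (-2 : ℝ) 2, ‖G x‖ ≤ B)
    (hμ : ∀ k < n, ‖∫ x in (-2 : ℝ)..2, (x : ℂ) ^ k * G x‖ ≤ μ) (hs : |s| ≤ n / 12) :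
    ‖∫ y in (-2 : ℝ)..2, Complex.exp (s * y * Complex.I) * G y‖
      ≤ Real.exp n * μ + 8 * B * (1 / 2) ^ n := by
  have hB : 0 ≤ B := (norm_nonneg _).trans (hGB 0 (by norm_num))
  have hμ0 : 0 ≤ μ := (norm_nonneg _).trans (hμ 0 hn)
  set p : ℝ → ℂ := fun y => ∑ k ∈ Finset.range n, (s * y * Complex.I) ^ k / (k ! : ℂ) with hp
  have hpc : Continuous p := by fun_prop
  have hsplit : ∫ y in (-2 : ℝ)..2, Complex.exp (s * y * Complex.I) * G y
      = (∫ y in (-2 : ℝ)..2, (Complex.exp (s * y * Complex.I) - p y) * G y)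
        + ∑ k ∈ Finset.range n, (s * Complex.I) ^ k / (k ! : ℂ) *
          ∫ y in (-2 : ℝ)..2, (y : ℂ) ^ k * G y := by
    have h1 : ∑ k ∈ Finset.range n, (s * Complex.I) ^ k / (k ! : ℂ) *
        ∫ y in (-2 : ℝ)..2, (y : ℂ) ^ k * G y = ∫ y in (-2 : ℝ)..2, p y * G y := by
      simp_rw [← intervalIntegral.integral_const_mul]
      rw [← intervalIntegral.integral_finsetSum]
      · refine intervalIntegral.integral_congr fun y _ => ?_
        simp only [hp, Finset.sum_mul]
        refine Finset.sum_congr rfl fun k _ => ?_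
        ring
      · intro k _
        exact (by fun_prop : Continuous _).intervalIntegrable _ _
    rw [h1, ← intervalIntegral.integral_add]
    · refine intervalIntegral.integral_congr fun y _ => ?_
      ring
    · exact (by fun_prop : Continuous _).intervalIntegrable _ _
    · exact (by fun_prop : Continuous _).intervalIntegrable _ _
  have hrem : ∀ y ∈ Set.uIoc (-2 : ℝ) 2, ‖(Complex.exp (s * y * Complex.I) - p y) * G y‖
      ≤ 2 * (1 / 2) ^ n * B := by
    intro y hy
    rw [Set.uIoc_of_le (by norm_num)] at hy
    have hn0 : (0 : ℝ) ≤ n := by positivity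
    have hy2 : |y| ≤ 2 := abs_le.mpr ⟨hy.1.le, hy.2⟩
    have hz : ‖(s * y * Complex.I : ℂ)‖ ≤ n / 6 := by
      simp only [norm_mul, Complex.norm_real, Complex.norm_I, mul_one, Real.norm_eq_abs]
      nlinarith [abs_nonneg s, abs_nonneg y]
    have h1 := Complex.exp_bound' (x := s * y * Complex.I) (n := n) (by
      rw [div_le_iff₀ (by positivity)]; push_cast; linarith)
    -- Since `n^n / n! ≤ e^n ≤ 3^n`, an argument of size at most `n/6` gives a tail of at most
    -- `(1/2)^n`. This is what the bound `n/12` on the frequency is for, as `|y| ≤ 2`.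
    have h2 : ‖(s * y * Complex.I : ℂ)‖ ^ n / n ! ≤ (1 / 2) ^ n := by
      have h3 := Real.pow_div_factorial_le_exp (x := n) hn0 n
      have he : Real.exp n ≤ 3 ^ n := by
        rw [← mul_one (n : ℝ), Real.exp_nat_mul]
        gcongr
        linarith [Real.exp_one_lt_d9]
      calc _ ≤ ((n : ℝ) / 6) ^ n / n ! := by gcongr
        _ = (1 / 6) ^ n * ((n : ℝ) ^ n / n !) := by rw [div_pow, one_div, inv_pow]; ring
        _ ≤ (1 / 6) ^ n * 3 ^ n := by gcongr; linarith
        _ = _ := by rw [← mul_pow]; norm_num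
    rw [norm_mul]
    gcongr
    · exact h1.trans (by linarith)
    · exact hGB y ⟨hy.1.le, hy.2⟩
  have hfirst := intervalIntegral.norm_integral_le_of_norm_le_const hrem
  norm_num at hfirst
  have hsum : ‖∑ k ∈ Finset.range n, (s * Complex.I) ^ k / (k ! : ℂ) *
      ∫ y in (-2 : ℝ)..2, (y : ℂ) ^ k * G y‖ ≤ Real.exp n * μ := by
    have h1 : ∑ k ∈ Finset.range n, |s| ^ k / k ! ≤ Real.exp n :=
      (Real.sum_le_exp_of_nonneg (abs_nonneg s) n).trans (Real.exp_le_exp.mpr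
        (hs.trans (by linarith [show (0 : ℝ) ≤ n by positivity])))
    calc _ ≤ ∑ k ∈ Finset.range n, |s| ^ k / k ! * μ := by
          refine norm_sum_le_of_le _ fun k hk => ?_
          rw [norm_mul]
          gcongr
          · simp
          · exact hμ k (Finset.mem_range.mp hk)
      _ = (∑ k ∈ Finset.range n, |s| ^ k / k !) * μ := by rw [Finset.sum_mul]
      _ ≤ _ := by gcongr
  rw [hsplit]
  refine (norm_add_le _ _).trans ?_
  norm_num at hfirst ⊢
  linarith

/-- A Hölder function is small if it is close to a function whose moments are small. -/
theorem exists_norm_le_of_moments : ∃ A : ℝ, 0 < A ∧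
    ∀ {α H B δ μ : ℝ} {n : ℕ} {g G : ℝ → ℂ}, 0 ≤ α → α ≤ 1 → 0 < n → Continuous g →
      Continuous G → (∀ x y, ‖g x - g y‖ ≤ H * |x - y| ^ α) →
      (∀ x, x ∉ Set.Ioc (-2 : ℝ) 2 → g x = 0) → (∀ x ∈ Set.Icc (-2 : ℝ) 2, ‖G x‖ ≤ B) →
      (∀ x ∈ Set.Icc (-2 : ℝ) 2, ‖g x - G x‖ ≤ δ) →
      (∀ k < n, ‖∫ x in (-2 : ℝ)..2, (x : ℂ) ^ k * G x‖ ≤ μ) →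
      ∀ x, ‖g x‖ ≤ A * (H * (n : ℝ) ^ (-α) + δ + n * (Real.exp n * μ + 8 * B * (1 / 2) ^ n)) := by
  obtain ⟨K, ρ, hK⟩ := exists_isBandlimitedKernel
  have hI1 : Integrable fun z => ‖K z‖ := hK.integrable.norm
  set A₀ := (∫ z, ‖K z‖) with hA₀
  set A₁ := (∫ z, |z| * ‖K z‖) with hA₁
  have hA₀0 : 0 ≤ A₀ := integral_nonneg fun z => norm_nonneg _
  have hA₁0 : 0 ≤ A₁ := integral_nonneg fun z => by positivity
  refine ⟨100 * (A₀ + A₁) + 1, by positivity, ?_⟩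
  intro α H B δ μ n g G hα hα1 hn hg hG hH hgs hGB hδ hμ x
  have hn' : (0 : ℝ) < n := by exact_mod_cast hn
  -- Chosen so that `2π T < n/12`: all frequencies of the mollifier at scale `1/T` are within reach
  -- of `n` moments.
  set T : ℝ := n / 100 with hT
  have hT0 : 0 < T := by positivity
  have hHn : 0 ≤ H := by simpa using (norm_nonneg _).trans (hH 0 1)
  have hδn : 0 ≤ δ := (norm_nonneg _).trans (hδ 0 (by norm_num))
  set W := Real.exp n * μ + 8 * B * (1 / 2) ^ n with hW
  -- the mollified function is close to `g`
  obtain ⟨Bg, hBg⟩ : ∃ Bg, ∀ y, ‖g y‖ ≤ Bg := by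
    obtain ⟨Bg, hBg⟩ := (isCompact_Icc (a := (-2 : ℝ)) (b := 2)).exists_bound_of_continuousOn
      hg.continuousOn
    refine ⟨max Bg 0, fun y => ?_⟩
    by_cases hy : y ∈ Set.Ioc (-2 : ℝ) 2
    · exact (hBg y ⟨hy.1.le, hy.2⟩).trans (le_max_left _ _)
    · rw [hgs y hy, norm_zero]; exact le_max_right _ _
  have hIg : Integrable fun z => K z * g (x - z / T) := by
    refine hK.integrable.mul_bdd (c := Bg) (by fun_prop) (.of_forall fun z => hBg _)
  have h1 : ‖g x - ∫ z, K z * g (x - z / T)‖ ≤ 100 * (A₀ + A₁) * (H * (n : ℝ) ^ (-α)) := by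
    have e1 : g x - ∫ z, K z * g (x - z / T) = ∫ z, K z * (g x - g (x - z / T)) := by
      have : g x = ∫ z, K z * g x := by rw [integral_mul_const, hK.integral_eq_one, one_mul]
      conv_lhs => rw [this]
      rw [← integral_sub (hK.integrable.mul_const _) hIg]
      simp_rw [mul_sub]
    rw [e1]
    have hbd : ∀ z, ‖K z * (g x - g (x - z / T))‖
        ≤ (100 * H * (n : ℝ) ^ (-α)) * (‖K z‖ + |z| * ‖K z‖) := fun z => by
      have h2 := hH x (x - z / T)
      have h3 : |x - (x - z / T)| ^ α ≤ 100 * (n : ℝ) ^ (-α) * (1 + |z|) := by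
        have : x - (x - z / T) = z * 100 / n := by rw [hT]; field_simp; ring
        rw [this, abs_div, abs_mul, Nat.abs_cast, Real.div_rpow (by positivity) hn'.le,
          Real.mul_rpow (by positivity) (by positivity), Real.rpow_neg hn'.le, div_eq_mul_inv]
        have h4 : |z| ^ α ≤ 1 + |z| := by
          calc |z| ^ α ≤ (1 + |z|) ^ α := by gcongr; linarith
            _ ≤ (1 + |z|) ^ (1 : ℝ) :=
              Real.rpow_le_rpow_of_exponent_le (by linarith [abs_nonneg z]) hα1
            _ = _ := Real.rpow_one _
        have h5 : |(100 : ℝ)| ^ α ≤ 100 := by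
          calc |(100 : ℝ)| ^ α ≤ |(100 : ℝ)| ^ (1 : ℝ) :=
              Real.rpow_le_rpow_of_exponent_le (by norm_num) hα1
            _ = _ := by norm_num
        calc _ ≤ (1 + |z|) * 100 * ((n : ℝ) ^ α)⁻¹ := by gcongr
          _ = _ := by ring
      rw [norm_mul]
      calc ‖K z‖ * ‖g x - g (x - z / T)‖
          ≤ ‖K z‖ * (H * (100 * (n : ℝ) ^ (-α) * (1 + |z|))) := by
            gcongr; exact h2.trans (by gcongr)
        _ = _ := by ring
    refine (norm_integral_le_of_norm_le ((hI1.add hK.integrable_moment).const_mul _)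
      (.of_forall hbd)).trans (le_of_eq ?_)
    simp only [Pi.add_apply]
    rw [integral_const_mul, integral_add hI1 hK.integrable_moment]
    ring
  have h2 : ∫ z, K z * g (x - z / T)
      = ∫ y in (-2 : ℝ)..2, (T * K (T * (x - y))) * g y := by
    rw [← integral_scale_comp_sub _ hT0 x, intervalIntegral.integral_eq_integral_of_support_subset]
    · refine integral_congr_ae (.of_forall fun y => ?_)
      simp only [Complex.real_smul, mul_div_cancel_left₀ _ hT0.ne', sub_sub_cancel]
      ring
    · intro y hy
      by_contra hcon
      exact right_ne_zero_of_mul hy (hgs y hcon)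
  have hKc : Continuous fun y => (T * K (T * (x - y)) : ℂ) := by
    have := hK.continuous; fun_prop
  have h3 : ‖(∫ y in (-2 : ℝ)..2, (T * K (T * (x - y))) * g y)
      - ∫ y in (-2 : ℝ)..2, (T * K (T * (x - y))) * G y‖ ≤ A₀ * δ := by
    have hig : IntervalIntegrable (fun y => (T * K (T * (x - y))) * g y) volume (-2) 2 :=
      (hKc.mul hg).intervalIntegrable _ _
    have hiG : IntervalIntegrable (fun y => (T * K (T * (x - y))) * G y) volume (-2) 2 :=
      (hKc.mul hG).intervalIntegrable _ _
    rw [← intervalIntegral.integral_sub hig hiG, intervalIntegral.integral_of_le (by norm_num)]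
    have hint : Integrable fun y => T • ‖K (T * (x - y))‖ := by
      have := (hI1.comp_mul_left' hT0.ne').comp_sub_left x
      exact this.smul T
    calc _ ≤ ∫ y in Set.Ioc (-2 : ℝ) 2, T • ‖K (T * (x - y))‖ * δ := by
          refine norm_integral_le_of_norm_le (hint.mul_const δ).integrableOn ?_
          refine (ae_restrict_iff' measurableSet_Ioc).mpr (.of_forall fun y hy => ?_)
          rw [← mul_sub, norm_mul, norm_mul, Complex.norm_real, Real.norm_of_nonneg hT0.le]
          exact mul_le_mul_of_nonneg_left (hδ y ⟨hy.1.le, hy.2⟩) (by positivity)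
      _ ≤ ∫ y, T • ‖K (T * (x - y))‖ * δ :=
          setIntegral_le_integral (hint.mul_const δ) (.of_forall fun y => by
            simp only [smul_eq_mul, Pi.zero_apply]; positivity)
      _ = A₀ * δ := by
          rw [integral_mul_const, integral_scale_comp_sub (fun z => ‖K z‖) hT0]
  -- the mollification of `G` is a superposition of low frequencies
  have h4 : ∫ y in (-2 : ℝ)..2, (T * K (T * (x - y))) * G y
      = T * ∫ t in (-1 : ℝ)..1, (Complex.exp (-(2 * Real.pi * t * T * x * Complex.I)) * ρ t) *
        ∫ y in (-2 : ℝ)..2, Complex.exp ((2 * Real.pi * t * T : ℝ) * y * Complex.I) * G y := by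
    have hρ := hK.continuous_density
    simp_rw [← intervalIntegral.integral_const_mul]
    rw [← intervalIntegral_swap_of_continuous (F := fun y t => (T : ℂ) *
      (Complex.exp (-(2 * Real.pi * t * T * x * Complex.I)) * ρ t *
        (Complex.exp ((2 * Real.pi * t * T : ℝ) * y * Complex.I) * G y))) (by fun_prop)]
    refine intervalIntegral.integral_congr fun y _ => ?_
    simp only [hK.eq_integral]
    rw [← intervalIntegral.integral_const_mul, ← intervalIntegral.integral_mul_const]
    refine intervalIntegral.integral_congr fun t _ => ?_
    have : Complex.exp (-(2 * Real.pi * t * (T * (x - y) : ℝ) * Complex.I))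
        = Complex.exp (-(2 * Real.pi * t * T * x * Complex.I)) *
          Complex.exp ((2 * Real.pi * t * T : ℝ) * y * Complex.I) := by
      rw [← Complex.exp_add]; congr 1; push_cast; ring
    simp only [this]
    ring
  have h5 : ‖∫ y in (-2 : ℝ)..2, (T * K (T * (x - y))) * G y‖ ≤ n * W := by
    have hb : ∀ t ∈ Set.uIoc (-1 : ℝ) 1,
        ‖(Complex.exp (-(2 * Real.pi * t * T * x * Complex.I)) * ρ t) *
        ∫ y in (-2 : ℝ)..2, Complex.exp ((2 * Real.pi * t * T : ℝ) * y * Complex.I) * G y‖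
          ≤ W := by
      intro t ht
      rw [Set.uIoc_of_le (by norm_num)] at ht
      have ht1 : |t| ≤ 1 := abs_le.mpr ⟨ht.1.le, ht.2⟩
      have hE := norm_integral_exp_mul_le (s := 2 * Real.pi * t * T) hn hG hGB hμ (by
        rw [abs_mul, abs_mul, abs_of_pos (by positivity : 0 < 2 * Real.pi), abs_of_pos hT0, hT]
        have hpi := Real.pi_lt_d2
        have : 2 * Real.pi * |t| ≤ 2 * 3.15 * 1 := by gcongr
        nlinarith)
      have he : ‖Complex.exp (-(2 * Real.pi * t * T * x * Complex.I))‖ = 1 := by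
        rw [show (-(2 * Real.pi * t * T * x * Complex.I) : ℂ)
          = ((-(2 * Real.pi * t * T * x) : ℝ) : ℂ) * Complex.I by push_cast; ring]
        exact Complex.norm_exp_ofReal_mul_I _
      rw [norm_mul, norm_mul, he, one_mul]
      calc _ ≤ 1 * W := by gcongr; exact hK.norm_density_le t
        _ = W := one_mul _
    have := intervalIntegral.norm_integral_le_of_norm_le_const hb
    have hW0 : 0 ≤ W := (norm_nonneg _).trans (hb 0 (by norm_num [Set.uIoc_of_le]))
    rw [h4, norm_mul, Complex.norm_real, Real.norm_of_nonneg hT0.le]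
    rw [show |(1 : ℝ) - -1| = 2 by norm_num] at this
    calc _ ≤ T * (W * 2) := by gcongr
      _ ≤ n * W := by rw [hT]; nlinarith [mul_nonneg hn'.le hW0]
  have hfin : ‖g x‖ ≤ 100 * (A₀ + A₁) * (H * (n : ℝ) ^ (-α)) + A₀ * δ + n * W := by
    rw [h2] at h1
    calc ‖g x‖ = ‖(g x - ∫ y in (-2 : ℝ)..2, (T * K (T * (x - y))) * g y)
          + ((∫ y in (-2 : ℝ)..2, (T * K (T * (x - y))) * g y)
            - ∫ y in (-2 : ℝ)..2, (T * K (T * (x - y))) * G y)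
          + ∫ y in (-2 : ℝ)..2, (T * K (T * (x - y))) * G y‖ := by congr 1; ring
      _ ≤ _ := (norm_add₃_le).trans (by gcongr)
  have hX : 0 ≤ H * (n : ℝ) ^ (-α) := by positivity
  have hY : 0 ≤ n * W := (norm_nonneg _).trans h5
  refine hfin.trans ?_
  nlinarith [mul_nonneg hA₀0 hX, mul_nonneg hA₀0 hδn, mul_nonneg hA₀0 hY, mul_nonneg hA₁0 hX,
    mul_nonneg hA₁0 hδn, mul_nonneg hA₁0 hY]

/-! ### The test bump and averages against it -/

theorem mul_sub_le_integral {f : ℝ → ℝ} {a b c d K : ℝ} (hf : Continuous f)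
    (h0 : ∀ x ∈ Set.Icc a b, 0 ≤ f x) (hK : ∀ x ∈ Set.Icc c d, K ≤ f x)
    (hac : a ≤ c) (hcd : c ≤ d) (hdb : d ≤ b) : K * (d - c) ≤ ∫ x in a..b, f x := by
  have h1 : ∫ x in c..d, f x ≤ ∫ x in a..b, f x :=
    intervalIntegral.integral_mono_interval hac hcd hdb
      ((ae_restrict_iff' measurableSet_Ioc).mpr (.of_forall fun x hx => h0 x ⟨hx.1.le, hx.2⟩))
      (hf.intervalIntegrable _ _)
  refine le_trans ?_ h1
  calc K * (d - c) = ∫ _ in c..d, K := by simp [mul_comm]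
    _ ≤ _ := intervalIntegral.integral_mono_on hcd intervalIntegrable_const
      (hf.intervalIntegrable _ _) hK

/-- A normalised nonnegative bump on `[-h, h] × [γ - h, γ]`, vanishing to order `2n` at `ξ = ±h`,
with control of the first `2n` derivatives in `ξ`. -/
theorem exists_bump_isJet {h γ : ℝ} (n : ℕ) (h0 : 0 < h) (hhγ : h ≤ γ) (hγ : γ < 1) :
    ∃ F : ℕ → ℝ → ℝ → ℂ, ∃ p : ℝ → ℝ → ℝ, IsJet F ∧ (∀ i ξ η, γ ≤ η → F i ξ η = 0) ∧
      (∀ i < 2 * n, ∀ η, F i (-h) η = 0) ∧ (∀ i < 2 * n, ∀ η, F i h η = 0) ∧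
      (∀ i ≤ 2 * n, ∀ ξ ∈ Set.Icc (-h) h, ∀ η,
        ‖F i ξ η‖ ≤ 3 / h ^ 2 * 6 ^ (2 * n) * ((2 * n : ℕ) / h) ^ i) ∧
      (∀ ξ η, F 0 ξ η = p ξ η) ∧ (∀ ξ η, 0 ≤ p ξ η) ∧
      (∀ ξ η, η ∉ Set.Icc (γ - h) γ → p ξ η = 0) ∧
      Continuous (fun q : ℝ × ℝ => p q.1 q.2) ∧
      ∫ ξ in -h..h, ∫ η in (-1 : ℝ)..1, p ξ η = 1 := by
  set N := 2 * n with hN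
  -- Mere continuity in `η` suffices, since the operator only integrates in that variable.
  set c : ℝ → ℝ := fun η => max 0 ((γ - η) * (η - γ + h)) with hc
  set q : ℝ → ℝ := fun ξ => (ξ - h) ^ N * (ξ + h) ^ N with hq
  have hcc : Continuous c := by fun_prop
  have hqc : Continuous q := by fun_prop
  have hc0 : ∀ η, 0 ≤ c η := fun η => le_max_left _ _
  have hq0 : ∀ ξ, 0 ≤ q ξ := fun ξ => by
    have he : Even N := ⟨n, by omega⟩
    exact mul_nonneg (he.pow_nonneg _) (he.pow_nonneg _)
  have hcle : ∀ η, c η ≤ h ^ 2 / 4 := fun η =>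
    max_le (by positivity) (by nlinarith [sq_nonneg (2 * (η - γ) + h)])
  have hcz : ∀ η, η ∉ Set.Ioo (γ - h) γ → c η = 0 := fun η hη => by
    refine max_eq_left ?_
    rcases le_or_gt γ η with h1 | h1
    · exact mul_nonpos_of_nonpos_of_nonneg (by linarith) (by linarith)
    · have : η ≤ γ - h := not_lt.mp fun h2 => hη ⟨h2, h1⟩
      exact mul_nonpos_of_nonneg_of_nonpos (by linarith) (by linarith)
  set Z₁ := ∫ ξ in -h..h, q ξ with hZ₁
  set Z₂ := ∫ η in (-1 : ℝ)..1, c η with hZ₂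
  have hZ₁le : (3 * h ^ 2 / 4) ^ N * h ≤ Z₁ := by
    have := mul_sub_le_integral (a := -h) (b := h) (c := -(h / 2)) (d := h / 2)
      (K := (3 * h ^ 2 / 4) ^ N) hqc (fun x _ => hq0 x) (fun x hx => by
        have he : Even N := ⟨n, by omega⟩
        have h1 : q x = (h ^ 2 - x ^ 2) ^ N := by
          simp only [hq]
          rw [← mul_pow, ← he.neg_pow]; ring
        rw [h1]
        gcongr
        nlinarith [hx.1, hx.2]) (by linarith) (by linarith) (by linarith)
    calc _ = _ := by ring
      _ ≤ _ := this
  have hZ₂le : 3 * h ^ 3 / 32 ≤ Z₂ := by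
    have := mul_sub_le_integral (a := -1) (b := 1) (c := γ - 3 * h / 4) (d := γ - h / 4)
      (K := 3 * h ^ 2 / 16) hcc (fun x _ => hc0 x) (fun x hx => by
        refine le_max_of_le_right ?_
        nlinarith [hx.1, hx.2]) (by linarith) (by linarith) (by linarith)
    calc _ = _ := by ring
      _ ≤ _ := this
  have hZ₁0 : 0 < Z₁ := lt_of_lt_of_le (by positivity) hZ₁le
  have hZ₂0 : 0 < Z₂ := lt_of_lt_of_le (by positivity) hZ₂le
  set κ : ℝ := 1 / (Z₁ * Z₂) with hκ
  have hκ0 : 0 < κ := by positivity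
  have hj : IsJet (jetMul (powJet h N) (powJet (-h) N)) :=
    (isJet_powJet h N).mul (isJet_powJet (-h) N)
  refine ⟨fun i ξ η => (κ * c η : ℝ) * jetMul (powJet h N) (powJet (-h) N) i ξ η,
    fun ξ η => κ * c η * q ξ, ⟨fun i => ?_, fun i ξ η => ?_⟩, fun i ξ η hη => ?_,
    fun i hi η => ?_, fun i hi η => ?_, fun i hi ξ hξ η => ?_, fun ξ η => ?_, fun ξ η => ?_,
    fun ξ η hη => ?_, by fun_prop, ?_⟩
  · have := hj.continuous i
    fun_prop
  · exact (hj.hasDerivAt i ξ η).const_mul _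
  · simp only
    rw [hcz η fun h => absurd h.2 (not_lt.mpr hη)]; simp
  · simp only
    rw [jetMul_eq_zero (fun l hl => powJet_self (lt_of_le_of_lt hl hi) η), mul_zero]
  · simp only
    rw [jetMul_eq_zero_left (fun l hl => powJet_self (lt_of_le_of_lt hl hi) η), mul_zero]
  · have hξ' : |ξ| ≤ h := abs_le.mpr hξ
    have h1 := norm_jetMul_le (F := powJet h N) (G := powJet (-h) N) (ξ := ξ) (η := η) (i := i)
      (P := (2 * h) ^ N) (Q := (2 * h) ^ N) (a := N / (2 * h)) (b := N / (2 * h))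
      (by positivity) (by positivity)
      (fun l hl => norm_powJet_le h0 (abs_of_pos h0).le hξ' (hl.trans hi) η)
      (fun l hl => norm_powJet_le h0 (by rw [abs_neg, abs_of_pos h0]) hξ' (hl.trans hi) η)
    -- The normalisation is bounded by the mass on the middle halves of the two intervals. Compared
    -- with the bound `(2h)^N` for each of the two powers, this costs `16/3 ≤ 6` per order.
    have hκle : κ ≤ 1 / ((3 * h ^ 2 / 4) ^ N * h * (3 * h ^ 3 / 32)) := by
      rw [hκ]; gcongr
    rw [norm_mul, Complex.norm_real, Real.norm_of_nonneg (mul_nonneg hκ0.le (hc0 η))]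
    have e1 : (N : ℝ) / (2 * h) + N / (2 * h) = N / h := by field_simp; ring
    rw [e1] at h1
    have e2 : 1 / ((3 * h ^ 2 / 4) ^ N * h * (3 * h ^ 3 / 32)) * (h ^ 2 / 4) *
        ((2 * h) ^ N * (2 * h) ^ N) = 8 / 3 / h ^ 2 * (16 / 3) ^ N := by
      rw [← mul_pow, show 2 * h * (2 * h) = (16 / 3) * (3 * h ^ 2 / 4) by ring, mul_pow]
      field_simp
      norm_num
    calc κ * c η * ‖jetMul (powJet h N) (powJet (-h) N) i ξ η‖
        ≤ 1 / ((3 * h ^ 2 / 4) ^ N * h * (3 * h ^ 3 / 32)) * (h ^ 2 / 4) *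
          ((2 * h) ^ N * (2 * h) ^ N * (N / h) ^ i) := by
          have := hc0 η
          gcongr
          exact hcle η
      _ = 8 / 3 / h ^ 2 * (16 / 3) ^ N * (N / h) ^ i := by rw [← e2]; ring
      _ ≤ _ := by gcongr <;> norm_num
  · simp [jetMul, powJet, hq, mul_assoc]
  · exact mul_nonneg (mul_nonneg hκ0.le (hc0 η)) (hq0 ξ)
  · simp only
    rw [hcz η fun h => hη ⟨h.1.le, h.2.le⟩]; simp
  · simp only [intervalIntegral.integral_mul_const, intervalIntegral.integral_const_mul, ← hZ₁,
      ← hZ₂, hκ]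
    field_simp

/-- An average against a normalised density is close to every value that the averaged function is
close to. -/
theorem norm_sliceAvg_sub_le {u : ℝ → ℝ → ℂ} {w : ℝ → ℝ → ℝ → ℂ} {ψ : ℝ → ℝ → ℂ}
    {p : ℝ → ℝ → ℝ} {h γ δ x : ℝ} {c : ℂ} (hu : Continuous fun q : ℝ × ℝ => u q.1 q.2)
    (hw : Continuous fun q : ℝ × ℝ × ℝ => w q.1 q.2.1 q.2.2) (h0 : 0 < h)
    (hψ : ∀ ξ η, ψ ξ η = p ξ η) (hp : ∀ ξ η, 0 ≤ p ξ η)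
    (hpz : ∀ ξ η, η ∉ Set.Icc (γ - h) γ → p ξ η = 0)
    (hpc : Continuous fun q : ℝ × ℝ => p q.1 q.2)
    (hpi : ∫ ξ in -h..h, ∫ η in (-1 : ℝ)..1, p ξ η = 1)
    (hδ : ∀ ξ ∈ Set.Icc (-h) h, ∀ η ∈ Set.Icc (γ - h) γ,
      ‖u x (ξ * x + η) * w x ξ η - c‖ ≤ δ) :
    ‖sliceAvg u w h ψ x - c‖ ≤ δ := by
  have hwx : Continuous fun p : ℝ × ℝ => w x p.1 p.2 :=
    hw.comp (by fun_prop : Continuous fun p : ℝ × ℝ => (x, p.1, p.2))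
  have hux : Continuous (u x) := hu.comp (by fun_prop : Continuous fun y => (x, y))
  have hc : ∫ ξ in -h..h, ∫ η in (-1 : ℝ)..1, c * (p ξ η : ℂ) = c := by
    simp only [intervalIntegral.integral_const_mul, intervalIntegral.integral_ofReal, hpi]
    simp
  have hsub := intervalIntegral_intervalIntegral_sub
    (F := fun ξ η => u x (ξ * x + η) * (w x ξ η * ψ ξ η)) (G := fun ξ η => c * (p ξ η : ℂ))
    (by simp only [hψ]; fun_prop) (by fun_prop) (-h) h (-1) 1
  rw [hc] at hsub
  unfold sliceAvg
  rw [← hsub]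
  have hpr (ξ : ℝ) : Continuous (p ξ) := hpc.comp (by fun_prop : Continuous fun y => (ξ, y))
  have hpt : ∀ ξ ∈ Set.Icc (-h) h, ∀ η,
      ‖u x (ξ * x + η) * (w x ξ η * ψ ξ η) - c * (p ξ η : ℂ)‖ ≤ δ * p ξ η := fun ξ hξ η => by
    by_cases hη : η ∈ Set.Icc (γ - h) γ
    · rw [hψ, ← mul_assoc, ← sub_mul, norm_mul, Complex.norm_real, Real.norm_of_nonneg (hp ξ η)]
      have := hp ξ η
      gcongr
      exact hδ ξ hξ η hη
    · simp [hψ, hpz ξ η hη]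
  have hin : ∀ ξ ∈ Set.Icc (-h) h, ‖∫ η in (-1 : ℝ)..1,
      (u x (ξ * x + η) * (w x ξ η * ψ ξ η) - c * (p ξ η : ℂ))‖ ≤ δ * ∫ η in (-1 : ℝ)..1, p ξ η :=
    fun ξ hξ => by
      rw [← intervalIntegral.integral_const_mul]
      exact intervalIntegral.norm_integral_le_of_norm_le (by norm_num)
        (.of_forall fun η _ => hpt ξ hξ η)
        (((hpr ξ).const_mul δ).intervalIntegrable _ _)
  calc _ ≤ ∫ ξ in -h..h, δ * ∫ η in (-1 : ℝ)..1, p ξ η :=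
        intervalIntegral.norm_integral_le_of_norm_le (by linarith)
          (.of_forall fun ξ hξ => hin ξ ⟨hξ.1.le, hξ.2⟩)
          (((intervalIntegral.continuous_parametric_intervalIntegral_of_continuous'
            (f := p) hpc _ _).const_mul δ).intervalIntegrable _ _)
    _ = δ := by rw [intervalIntegral.integral_const_mul, hpi, mul_one]

theorem continuous_sliceAvg {u : ℝ → ℝ → ℂ} {w : ℝ → ℝ → ℝ → ℂ} {ψ : ℝ → ℝ → ℂ} {h : ℝ}
    (hu : Continuous fun q : ℝ × ℝ => u q.1 q.2)
    (hw : Continuous fun q : ℝ × ℝ × ℝ => w q.1 q.2.1 q.2.2)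
    (hψ : Continuous fun q : ℝ × ℝ => ψ q.1 q.2) : Continuous (sliceAvg u w h ψ) := by
  have hc : Continuous fun q : ℝ × ℝ × ℝ => u q.1 (q.2.1 * q.1 + q.2.2) *
      (w q.1 q.2.1 q.2.2 * ψ q.2.1 q.2.2) :=
    (hu.comp (by fun_prop : Continuous fun q : ℝ × ℝ × ℝ => (q.1, q.2.1 * q.1 + q.2.2))).mul
      (hw.mul (hψ.comp continuous_snd))
  refine intervalIntegral.continuous_parametric_intervalIntegral_of_continuous'
    (f := fun x ξ => ∫ η in (-1 : ℝ)..1, u x (ξ * x + η) * (w x ξ η * ψ ξ η)) ?_ _ _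
  exact intervalIntegral.continuous_parametric_intervalIntegral_of_continuous'
    (f := fun (q : ℝ × ℝ) η => u q.1 (q.2 * q.1 + η) * (w q.1 q.2 η * ψ q.2 η))
    (hc.comp (by fun_prop : Continuous fun q : (ℝ × ℝ) × ℝ => (q.1.1, q.1.2, q.2))) _ _

/-! ### The gauge and the Gevrey bounds -/

theorem hasDerivAt_fst_of_contDiff {g : ℝ → ℝ → ℂ} (hg : ContDiff ℝ ∞ fun p : ℝ × ℝ => g p.1 p.2)
    (ξ η : ℝ) : HasDerivAt (fun t => g t η)
      (fderiv ℝ (fun p : ℝ × ℝ => g p.1 p.2) (ξ, η) (1, 0)) ξ :=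
  ((hg.differentiable (by simp)).differentiableAt (x := (ξ, η))).hasFDerivAt.comp_hasDerivAt
    (f := fun t => (t, η)) ξ ((hasDerivAt_id ξ).prodMk (hasDerivAt_const ξ η))

theorem hasDerivAt_snd_of_contDiff {g : ℝ → ℝ → ℂ} (hg : ContDiff ℝ ∞ fun p : ℝ × ℝ => g p.1 p.2)
    (ξ η : ℝ) : HasDerivAt (fun t => g ξ t)
      (fderiv ℝ (fun p : ℝ × ℝ => g p.1 p.2) (ξ, η) (0, 1)) η :=
  ((hg.differentiable (by simp)).differentiableAt (x := (ξ, η))).hasFDerivAt.comp_hasDerivAt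
    (f := fun t => (ξ, t)) η ((hasDerivAt_const η ξ).prodMk (hasDerivAt_id η))

theorem contDiff_fderiv_apply {g : ℝ → ℝ → ℂ} (hg : ContDiff ℝ ∞ fun p : ℝ × ℝ => g p.1 p.2)
    (v : ℝ × ℝ) : ContDiff ℝ ∞ fun p : ℝ × ℝ => fderiv ℝ (fun p : ℝ × ℝ => g p.1 p.2) p v :=
  (hg.fderiv_right (m := ∞) (by simp)).clm_apply contDiff_const

/-- The iterated derivatives of a smooth function in the first variable. -/
theorem isJet_iteratedDeriv {g : ℝ → ℝ → ℂ} (hg : ContDiff ℝ ∞ fun p : ℝ × ℝ => g p.1 p.2) :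
    IsJet fun i ξ η => iteratedDeriv i (fun t => g t η) ξ := by
  have key : ∀ i, ContDiff ℝ ∞ fun p : ℝ × ℝ => iteratedDeriv i (fun t => g t p.2) p.1 := by
    intro i
    induction i with
    | zero => simpa using hg
    | succ i ih =>
      have h1 := contDiff_fderiv_apply (g := fun ξ η => iteratedDeriv i (fun t => g t η) ξ) ih
        (1, 0)
      convert h1 using 2 with p
      rw [iteratedDeriv_succ]
      exact (hasDerivAt_fst_of_contDiff (g := fun ξ η => iteratedDeriv i (fun t => g t η) ξ)
        ih p.1 p.2).deriv
  refine ⟨fun i => (key i).continuous, fun i ξ η => ?_⟩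
  have := hasDerivAt_fst_of_contDiff (g := fun ξ η => iteratedDeriv i (fun t => g t η) ξ)
    (key i) ξ η
  rw [iteratedDeriv_succ]
  exact this.differentiableAt.hasDerivAt

/-- The iterated derivatives of a Gevrey function in the first variable. -/
theorem IsGevrey.exists_isJet {σ : ℝ} {a : ℝ → ℝ → ℂ} (ha : IsGevrey σ a) :
    ∃ J : ℕ → ℝ → ℝ → ℂ, IsJet J ∧ J 0 = a ∧ ∀ K : Set (ℝ × ℝ), IsCompact K → ∃ C : ℝ, 0 < C ∧
      ∀ i, ∀ p ∈ K, ‖J i p.1 p.2‖ ≤ C ^ (i + 1) * (i ! : ℝ) ^ σ := by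
  refine ⟨_, isJet_iteratedDeriv ha.1, by simp, fun K hK => ?_⟩
  obtain ⟨C, hC, h⟩ := ha.2 K hK
  exact ⟨C, hC, fun i p hp => by simpa using h i 0 p hp⟩

/-- Multiplying a weight by `exp (∫_γ^η a)` removes the term `x a` from its equation. -/
theorem IsWeight.hasDerivAt_gauge {a b : ℝ → ℝ → ℂ} {m : ℝ → ℝ → ℝ → ℂ} (hm : IsWeight a b m)
    {J : ℕ → ℝ → ℝ → ℂ} (hJ : IsJet J) (hJa : J 0 = a) (γ x y ξ : ℝ) :
    HasDerivAt (fun t => m x t (y - t * x) * Complex.exp (jetInt γ J 0 t (y - t * x)))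
      ((b ξ (y - ξ * x) + jetInt γ J 1 ξ (y - ξ * x)) *
        (m x ξ (y - ξ * x) * Complex.exp (jetInt γ J 0 ξ (y - ξ * x)))) ξ := by
  have hmx : ContDiff ℝ ∞ fun p : ℝ × ℝ => m x p.1 p.2 :=
    hm.smooth.comp (by fun_prop : ContDiff ℝ ∞ fun p : ℝ × ℝ => (x, p.1, p.2))
  have h1 := hasDerivAt_along_line (contDiff_fderiv_apply hmx (1, 0)).continuous
    (contDiff_fderiv_apply hmx (0, 1)).continuous (hasDerivAt_fst_of_contDiff hmx)
    (hasDerivAt_snd_of_contDiff hmx) x y ξ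
  have heq := hm.equation x ξ (y - ξ * x)
  rw [(hasDerivAt_fst_of_contDiff hmx ξ (y - ξ * x)).deriv,
    (hasDerivAt_snd_of_contDiff hmx ξ (y - ξ * x)).deriv] at heq
  rw [heq] at h1
  have hi := hJ.int γ
  have h2 := (hasDerivAt_along_line (hi.continuous 1) (hJ.continuous 0) (hi.hasDerivAt 0)
    (hJ.hasDerivAt_int γ 0) x y ξ).cexp
  refine (h1.mul h2).congr_deriv ?_
  rw [hJa]
  ring

theorem factorial_succ_le_pow {n : ℕ} : ∀ l ≤ n, (l + 1)! ≤ (n + 1) ^ l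
  | 0, _ => by simp
  | l + 1, hl => by
    rw [Nat.factorial_succ, pow_succ']
    exact Nat.mul_le_mul (by omega) (factorial_succ_le_pow l (by omega))

/-- When at most `n` derivatives are in play, Gevrey growth can be replaced by geometric growth
whose ratio is a power of `n + 1`. Allowing `k = l + 1` accommodates the extra derivative of `a` in
the gauged coefficient. -/
theorem factorial_rpow_le {σ : ℝ} {s n l k : ℕ} (hσ : 0 ≤ σ) (hs : σ ≤ s) (hl : l ≤ n)
    (hk : k ≤ l + 1) : (k ! : ℝ) ^ σ ≤ (((n : ℝ) + 1) ^ s) ^ l := by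
  have h1 : (k ! : ℝ) ≤ ((n : ℝ) + 1) ^ l := by
    exact_mod_cast (Nat.factorial_le hk).trans (factorial_succ_le_pow l hl)
  calc (k ! : ℝ) ^ σ ≤ (((n : ℝ) + 1) ^ l) ^ σ := by gcongr
    _ ≤ (((n : ℝ) + 1) ^ l) ^ (s : ℝ) := by
      refine Real.rpow_le_rpow_of_exponent_le ?_ hs
      exact one_le_pow₀ (by linarith [show (0 : ℝ) ≤ n by positivity])
    _ = _ := by rw [Real.rpow_natCast, ← pow_mul, ← pow_mul, mul_comm]

/-- The coefficient of the gauged equation and the bounds on its derivatives. -/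
theorem exists_gauge_bounds {σ γ : ℝ} {s : ℕ} (hσ : 0 ≤ σ) (hs : σ ≤ s) (hγ : γ ≤ 1)
    {I J : ℕ → ℝ → ℝ → ℂ}
    (hI : ∀ K : Set (ℝ × ℝ), IsCompact K → ∃ C : ℝ, 0 < C ∧
      ∀ i, ∀ p ∈ K, ‖I i p.1 p.2‖ ≤ C ^ (i + 1) * (i ! : ℝ) ^ σ)
    (hJ : ∀ K : Set (ℝ × ℝ), IsCompact K → ∃ C : ℝ, 0 < C ∧
      ∀ i, ∀ p ∈ K, ‖J i p.1 p.2‖ ≤ C ^ (i + 1) * (i ! : ℝ) ^ σ) :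
    ∃ D : ℝ, 0 < D ∧ ∀ n : ℕ, ∀ i ≤ n, ∀ ξ ∈ Set.Icc (-1 : ℝ) 1, ∀ η ∈ Set.Icc (-γ) γ,
      ‖I i ξ η + jetInt γ J (i + 1) ξ η‖ ≤ D * (D * ((n : ℝ) + 1) ^ s) ^ i := by
  have hK : IsCompact (Set.Icc (-1 : ℝ) 1 ×ˢ Set.Icc (-γ) γ) := isCompact_Icc.prod isCompact_Icc
  obtain ⟨C₁, hC₁, h₁⟩ := hI _ hK
  obtain ⟨C₂, hC₂, h₂⟩ := hJ _ hK
  set D := C₁ + C₂ + 2 * C₂ ^ 2 with hD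
  have hD0 : 0 < D := by positivity
  refine ⟨D, hD0, fun n i hi ξ hξ η hη => ?_⟩
  have hX : (0 : ℝ) ≤ ((n : ℝ) + 1) ^ s := by positivity
  set X := ((n : ℝ) + 1) ^ s with hXdef
  have e1 : ‖I i ξ η‖ ≤ C₁ * (D * X) ^ i := by
    calc _ ≤ C₁ ^ (i + 1) * (i ! : ℝ) ^ σ := h₁ i (ξ, η) ⟨hξ, hη⟩
      _ ≤ C₁ ^ (i + 1) * X ^ i := by
        gcongr; exact factorial_rpow_le hσ hs hi (by omega)
      _ = C₁ * (C₁ * X) ^ i := by ring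
      _ ≤ _ := by gcongr; rw [hD]; nlinarith
  have e2 : ‖jetInt γ J (i + 1) ξ η‖ ≤ 2 * (C₂ ^ 2 * (D * X) ^ i) := by
    refine norm_jetInt_le hγ (fun t ht => ?_) hη
    calc _ ≤ C₂ ^ (i + 1 + 1) * ((i + 1)! : ℝ) ^ σ := h₂ (i + 1) (ξ, t) ⟨hξ, ht⟩
      _ ≤ C₂ ^ (i + 1 + 1) * X ^ i := by
        gcongr; exact factorial_rpow_le hσ hs hi le_rfl
      _ = C₂ ^ 2 * (C₂ * X) ^ i := by ring
      _ ≤ _ := by gcongr; rw [hD]; nlinarith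
  calc _ ≤ _ := norm_add_le _ _
    _ ≤ C₁ * (D * X) ^ i + 2 * (C₂ ^ 2 * (D * X) ^ i) := add_le_add e1 e2
    _ = (C₁ + 2 * C₂ ^ 2) * (D * X) ^ i := by ring
    _ ≤ _ := by gcongr; rw [hD]; linarith

/-! ### Continuity of the data, Hölder bounds and bookkeeping of constants -/

/-- The transform of a continuous function supported above a parabola is continuous. -/
theorem continuous_lineIntegral {u : ℝ → ℝ → ℂ} {m : ℝ → ℝ → ℝ → ℂ}
    (hu : Continuous fun p : ℝ × ℝ => u p.1 p.2) (hsupp : ∀ x y, y < x ^ 2 → u x y = 0)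
    (hm : Continuous fun p : ℝ × ℝ × ℝ => m p.1 p.2.1 p.2.2) :
    Continuous fun p : ℝ × ℝ => ∫ x, u x (p.1 * x + p.2) * m x p.1 p.2 := by
  refine continuous_iff_continuousAt.mpr fun p₀ => ?_
  set ρ : ℝ := |p₀.1| + |p₀.2| + 1 with hρ
  have hc : Continuous fun p : ℝ × ℝ =>
      ∫ x in -(ρ + 1)..(ρ + 1), u x (p.1 * x + p.2) * m x p.1 p.2 := by
    refine intervalIntegral.continuous_parametric_intervalIntegral_of_continuous'
      (f := fun (p : ℝ × ℝ) x => u x (p.1 * x + p.2) * m x p.1 p.2) ?_ _ _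
    exact (hu.comp (by fun_prop : Continuous fun q : (ℝ × ℝ) × ℝ =>
      (q.2, q.1.1 * q.2 + q.1.2))).mul
      (hm.comp (by fun_prop : Continuous fun q : (ℝ × ℝ) × ℝ => (q.2, q.1.1, q.1.2)))
  refine hc.continuousAt.congr ?_
  have hlt : ∀ᶠ p : ℝ × ℝ in nhds p₀, |p.1| + |p.2| < ρ :=
    (by fun_prop : Continuous fun p : ℝ × ℝ => |p.1| + |p.2|).continuousAt.eventually_lt
      continuousAt_const (by rw [hρ]; linarith)
  filter_upwards [hlt] with p hp
  refine intervalIntegral.integral_eq_integral_of_support_subset fun x hx => ?_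
  have h2 : u x (p.1 * x + p.2) ≠ 0 := left_ne_zero_of_mul hx
  have h3 : x ^ 2 ≤ p.1 * x + p.2 := not_lt.mp fun h => h2 (hsupp _ _ h)
  have h4 : p.1 * x ≤ |p.1| * |x| := by rw [← abs_mul]; exact le_abs_self _
  -- On the support `|x|² ≤ |p.1| |x| + |p.2|`, which fails for `|x| ≥ ρ + 1` because `|p.1| + |p.2|
  -- < ρ`.
  have h5 : |x| < ρ + 1 := by
    by_contra hcon
    have h6 : |x| ^ 2 = x ^ 2 := sq_abs x
    nlinarith [le_abs_self p.2, abs_nonneg p.1, abs_nonneg p.2, abs_nonneg x]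
  exact ⟨(abs_lt.mp h5).1, (abs_lt.mp h5).2.le⟩

theorem le_mul_rpow {α t c : ℝ} (hα : 0 < α) (hα1 : α ≤ 1) (hc : 1 ≤ c) (ht : 0 ≤ t)
    (htc : t ≤ c) : t ≤ c * t ^ α := by
  rcases ht.eq_or_lt with h0 | h0
  · rw [← h0, Real.zero_rpow hα.ne']; simp
  · have h1 : t ^ (1 - α) ≤ c := by
      calc t ^ (1 - α) ≤ c ^ (1 - α) := by gcongr
        _ ≤ c ^ (1 : ℝ) := Real.rpow_le_rpow_of_exponent_le hc (by linarith)
        _ = c := Real.rpow_one c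
    calc t = t ^ (1 - α) * t ^ α := by rw [← Real.rpow_add h0]; simp
      _ ≤ c * t ^ α := by gcongr

theorem exists_lipschitz_bound {m : ℝ → ℝ → ℝ → ℂ}
    (hm : ContDiff ℝ ∞ fun p : ℝ × ℝ × ℝ => m p.1 p.2.1 p.2.2) :
    ∃ L : ℝ, 0 ≤ L ∧ ∀ x ∈ Set.Icc (-2 : ℝ) 2, ∀ ξ ∈ Set.Icc (-1 : ℝ) 1,
      ∀ η ∈ Set.Icc (-1 : ℝ) 1, ‖m x ξ η‖ ≤ L ∧
      ∀ x' ∈ Set.Icc (-2 : ℝ) 2, ∀ ξ' ∈ Set.Icc (-1 : ℝ) 1, ∀ η' ∈ Set.Icc (-1 : ℝ) 1,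
        ‖m x ξ η - m x' ξ' η'‖ ≤ L * (|x - x'| + |ξ - ξ'| + |η - η'|) := by
  set g : ℝ × ℝ × ℝ → ℂ := fun p => m p.1 p.2.1 p.2.2 with hg
  set S : Set (ℝ × ℝ × ℝ) := Set.Icc (-2) 2 ×ˢ Set.Icc (-1) 1 ×ˢ Set.Icc (-1) 1 with hS
  have hSc : IsCompact S := isCompact_Icc.prod (isCompact_Icc.prod isCompact_Icc)
  have hSv : Convex ℝ S := (convex_Icc _ _).prod ((convex_Icc _ _).prod (convex_Icc _ _))
  obtain ⟨L₁, hL₁⟩ := hSc.exists_bound_of_continuousOn hm.continuous.continuousOn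
  obtain ⟨L₂, hL₂⟩ := hSc.exists_bound_of_continuousOn
    (hm.continuous_fderiv (by simp)).continuousOn
  refine ⟨max 0 (max L₁ L₂), le_max_left _ _, fun x hx ξ hξ η hη =>
    ⟨(hL₁ (x, ξ, η) ⟨hx, hξ, hη⟩).trans (le_max_of_le_right (le_max_left _ _)),
      fun x' hx' ξ' hξ' η' hη' => ?_⟩⟩
  have h1 := hSv.norm_image_sub_le_of_norm_fderiv_le (𝕜 := ℝ) (f := g)
    (fun p _ => (hm.differentiable (by simp)).differentiableAt) hL₂
    (x := (x', ξ', η')) (y := (x, ξ, η)) ⟨hx', hξ', hη'⟩ ⟨hx, hξ, hη⟩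
  have h2 : ‖(x, ξ, η) - (x', ξ', η')‖ ≤ |x - x'| + |ξ - ξ'| + |η - η'| := by
    simp only [Prod.mk_sub_mk, Prod.norm_mk, Real.norm_eq_abs]
    refine max_le ?_ (max_le ?_ ?_) <;>
      linarith [abs_nonneg (x - x'), abs_nonneg (ξ - ξ'), abs_nonneg (η - η')]
  refine h1.trans ?_
  gcongr
  exact le_max_of_le_right (le_max_right _ _)

theorem norm_exp_sub_one_le_mul_exp (z : ℂ) : ‖Complex.exp z - 1‖ ≤ ‖z‖ * Real.exp ‖z‖ := by
  simpa using Complex.norm_exp_sub_sum_le_norm_mul_exp z 1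

/-- Absorbs the Taylor tail into the Hölder error `n^(-α)`. -/
theorem nat_mul_half_pow_le {α : ℝ} (hα1 : α ≤ 1) {n : ℕ} (hn : 0 < n) :
    (n : ℝ) * (1 / 2) ^ n ≤ 4 * (n : ℝ) ^ (-α) := by
  -- The lower-order terms make the induction close: the left side at `k + 1` is at most twice its
  -- value at `k`.
  have h1 : ∀ k : ℕ, k ^ 2 + 2 * k + 3 ≤ 4 * 2 ^ k := by
    intro k
    induction k with
    | zero => norm_num
    | succ k ih => rw [pow_succ 2 k]; nlinarith
  have h2 : (n : ℝ) ^ 2 ≤ 4 * 2 ^ n := by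
    have : n ^ 2 ≤ 4 * 2 ^ n := by linarith [h1 n]
    exact_mod_cast this
  have hn' : (1 : ℝ) ≤ n := by exact_mod_cast hn
  have h3 : (n : ℝ)⁻¹ ≤ (n : ℝ) ^ (-α) := by
    rw [← Real.rpow_neg_one]
    exact Real.rpow_le_rpow_of_exponent_le hn' (by linarith)
  calc (n : ℝ) * (1 / 2) ^ n = (n : ℝ) ^ 2 / 2 ^ n * (n : ℝ)⁻¹ := by
        rw [one_div, inv_pow]; field_simp
    _ ≤ 4 * (n : ℝ) ^ (-α) := by
        gcongr
        rw [div_le_iff₀ (by positivity)]; exact h2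

theorem exists_le_nat_pow (C : ℝ) : ∃ K : ℕ, ∀ n : ℕ, 2 ≤ n → C ≤ (n : ℝ) ^ K := by
  obtain ⟨K, hK⟩ := pow_unbounded_of_one_lt C (by norm_num : (1 : ℝ) < 2)
  refine ⟨K, fun n hn => hK.le.trans ?_⟩
  gcongr
  exact_mod_cast hn

/-- All the constants occurring in the moment bounds are dominated by a power of `n ^ n`. -/
theorem exists_const_le_pow (A₀ D E : ℝ) (hA : 0 ≤ A₀) (hD : 0 ≤ D) (hE : 0 ≤ E) (s : ℕ) :
    ∃ P : ℕ, ∀ n : ℕ, 2 ≤ n →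
      A₀ * (n * (Real.exp n * (E * (3 * (n : ℝ) ^ 2 * 6 ^ (2 * n) *
        (2 * (2 * (n : ℝ) ^ 2 + n * (D * ((n : ℝ) + 1) ^ s) + D)) ^ n)))) ≤ (n : ℝ) ^ (P * n) := by
  obtain ⟨K₁, h₁⟩ := exists_le_nat_pow (A₀ * E * 3)
  obtain ⟨K₂, h₂⟩ := exists_le_nat_pow (3 * 36 * (2 * (2 + D * 2 ^ s + D)))
  -- `K₁ + 3` pays for the factors outside the `n`-th power, wastefully raised to the power `n`; `K₂
  -- + (s + 2)` pays for the base of that power.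
  refine ⟨K₁ + 3 + (K₂ + (s + 2)), fun n hn => ?_⟩
  have hn1 : (1 : ℝ) ≤ n := by exact_mod_cast (by omega : 1 ≤ n)
  have he : Real.exp n ≤ 3 ^ n := by
    rw [← mul_one (n : ℝ), Real.exp_nat_mul]
    gcongr
    linarith [Real.exp_one_lt_d9]
  have hbase : 2 * (2 * (n : ℝ) ^ 2 + n * (D * ((n : ℝ) + 1) ^ s) + D)
      ≤ 2 * (2 + D * 2 ^ s + D) * (n : ℝ) ^ (s + 2) := by
    have e1 : (n : ℝ) ^ 2 ≤ (n : ℝ) ^ (s + 2) := pow_le_pow_right₀ hn1 (by omega)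
    have e2 : n * ((n : ℝ) + 1) ^ s ≤ 2 ^ s * (n : ℝ) ^ (s + 2) := by
      calc n * ((n : ℝ) + 1) ^ s ≤ n * (2 * (n : ℝ)) ^ s := by gcongr; linarith
        _ = 2 ^ s * (n : ℝ) ^ (s + 1) := by ring
        _ ≤ _ := by gcongr; norm_num
    have e3 : 1 ≤ (n : ℝ) ^ (s + 2) := one_le_pow₀ hn1
    nlinarith [mul_le_mul_of_nonneg_left e2 hD, mul_le_mul_of_nonneg_left e3 hD]
  have hpow : (n : ℝ) ^ (K₁ + 3) ≤ ((n : ℝ) ^ (K₁ + 3)) ^ n :=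
    le_self_pow₀ (one_le_pow₀ hn1) (by omega)
  calc _ ≤ A₀ * (n * (3 ^ n * (E * (3 * (n : ℝ) ^ 2 * 6 ^ (2 * n) *
        (2 * (2 + D * 2 ^ s + D) * (n : ℝ) ^ (s + 2)) ^ n)))) := by gcongr
    _ = (A₀ * E * 3) * (n : ℝ) ^ 3 *
        ((3 * 36 * (2 * (2 + D * 2 ^ s + D))) * (n : ℝ) ^ (s + 2)) ^ n := by
      rw [pow_mul 6 2 n]; simp only [mul_pow]; norm_num; ring
    _ ≤ (n : ℝ) ^ K₁ * (n : ℝ) ^ 3 * ((n : ℝ) ^ K₂ * (n : ℝ) ^ (s + 2)) ^ n := by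
      gcongr
      · exact h₁ n hn
      · exact h₂ n hn
    _ = (n : ℝ) ^ (K₁ + 3) * ((n : ℝ) ^ (K₂ + (s + 2))) ^ n := by
      rw [← pow_add, ← pow_add]
    _ ≤ ((n : ℝ) ^ (K₁ + 3)) ^ n * ((n : ℝ) ^ (K₂ + (s + 2))) ^ n := by gcongr
    _ = _ := by rw [← mul_pow, ← pow_add, ← pow_mul]

/-- The function vanishes at `(x, -1)`, which lies below the parabola at distance at most 4, so
Hölder continuity alone bounds it. -/
theorem norm_le_of_holder_of_support {u : ℝ → ℝ → ℂ} {C₀ α : ℝ} (hC₀ : 0 ≤ C₀) (hα : 0 < α)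
    (hα1 : α ≤ 1)
    (hHol : ∀ x y x' y', ‖u x y - u x' y'‖ ≤ C₀ * (|x - x'| + |y - y'|) ^ α)
    (hsupp : ∀ x y, y < x ^ 2 → u x y = 0) (x y : ℝ) (hy : |y| ≤ 3) : ‖u x y‖ ≤ 4 * C₀ := by
  have h1 := hHol x y x (-1)
  rw [hsupp x (-1) (by nlinarith [sq_nonneg x]), sub_zero, sub_self, abs_zero, zero_add] at h1
  have h2 : |y - -1| ≤ 4 := (abs_sub _ _).trans (by rw [abs_neg, abs_one]; linarith)
  have h3 : |y - -1| ^ α ≤ 4 := by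
    calc |y - -1| ^ α ≤ 4 ^ α := by gcongr
      _ ≤ 4 ^ (1 : ℝ) := Real.rpow_le_rpow_of_exponent_le (by norm_num) hα1
      _ = 4 := Real.rpow_one 4
  calc _ ≤ C₀ * |y - -1| ^ α := h1
    _ ≤ C₀ * 4 := by gcongr
    _ = _ := mul_comm _ _

/-- Hölder regularity of a line restriction multiplied by a Lipschitz function. -/
theorem holder_mul_of_support {u : ℝ → ℝ → ℂ} {k : ℝ → ℂ} {C₀ α γ L : ℝ} (hC₀ : 0 ≤ C₀)
    (hα : 0 < α) (hα1 : α ≤ 1) (hL0 : 0 ≤ L) (hγ0 : 0 < γ) (hγ : γ < 1)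
    (hHol : ∀ x y x' y', ‖u x y - u x' y'‖ ≤ C₀ * (|x - x'| + |y - y'|) ^ α)
    (hsupp : ∀ x y, y < x ^ 2 → u x y = 0) (hk : ∀ x ∈ Set.Icc (-2 : ℝ) 2, ‖k x‖ ≤ L)
    (hkL : ∀ x ∈ Set.Icc (-2 : ℝ) 2, ∀ y ∈ Set.Icc (-2 : ℝ) 2, ‖k x - k y‖ ≤ L * |x - y|) :
    (∀ x, 1 ≤ |x| → u x γ * k x = 0) ∧ (∀ x ∈ Set.Icc (-2 : ℝ) 2, ‖u x γ * k x‖ ≤ 4 * C₀ * L) ∧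
      ∀ x y, ‖u x γ * k x - u y γ * k y‖ ≤ (5 * C₀ * L + 16 * C₀ * L) * |x - y| ^ α := by
  have hub := norm_le_of_holder_of_support hC₀ hα hα1 hHol hsupp
  have hγ3 : |γ| ≤ 3 := by rw [abs_of_pos hγ0]; linarith
  set H := 5 * C₀ * L + 16 * C₀ * L with hH
  have hH0 : 0 ≤ H := by positivity
  set g : ℝ → ℂ := fun x => u x γ * k x with hg
  have hgb : ∀ x ∈ Set.Icc (-2 : ℝ) 2, ‖g x‖ ≤ 4 * C₀ * L := fun x hx => by
    rw [hg, norm_mul]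
    gcongr
    · exact hub x γ hγ3
    · exact hk x hx
  have hgz : ∀ x, 1 ≤ |x| → g x = 0 := fun x hx => by
    simp only [hg]
    rw [hsupp x γ (by rw [← sq_abs]; nlinarith), zero_mul]
  refine ⟨hgz, hgb, ?_⟩
  change ∀ x y, ‖g x - g y‖ ≤ H * |x - y| ^ α
  -- The factor `k` is controlled only on `[-2, 2]`. A point beyond is at distance at least 1 from
  -- any point where `g` is nonzero, so the sup bound is already a Hölder bound.
  have hfar : ∀ x y, 2 < |y| → ‖g x‖ ≤ H * |x - y| ^ α := fun x y hy => by
    rcases le_or_gt 1 |x| with h1 | h1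
    · rw [hgz x h1, norm_zero]; positivity
    · have h2 : 1 ≤ |x - y| := by
        have := abs_sub_abs_le_abs_sub y x
        rw [abs_sub_comm] at this
        linarith
      have h3 : 1 ≤ |x - y| ^ α := Real.one_le_rpow h2 hα.le
      have h4 := hgb x (abs_le.mp (by linarith))
      have h5 : 0 ≤ C₀ * L := by positivity
      rw [hH]
      nlinarith
  intro x y
  rcases lt_or_ge 2 |y| with hy | hy
  · rw [hgz y (by linarith), sub_zero]; exact hfar x y hy
  rcases lt_or_ge 2 |x| with hx | hx
  · rw [hgz x (by linarith), zero_sub, norm_neg, abs_sub_comm]; exact hfar y x hx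
  have hx' := abs_le.mp hx
  have hy' := abs_le.mp hy
  have e1 : g x - g y = (u x γ - u y γ) * k x + u y γ * (k x - k y) := by
    simp only [hg]; ring
  have e2 := hHol x γ y γ
  have e3 := hkL x hx' y hy'
  simp only [sub_self, abs_zero, add_zero] at e2
  have e4 : |x - y| ≤ 4 * |x - y| ^ α := le_mul_rpow hα hα1 (by norm_num) (abs_nonneg _)
    ((abs_sub _ _).trans (by linarith))
  calc ‖g x - g y‖ ≤ ‖(u x γ - u y γ) * k x‖ + ‖u y γ * (k x - k y)‖ := by
        rw [e1]; exact norm_add_le _ _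
    _ ≤ (C₀ * |x - y| ^ α) * L + (4 * C₀) * (L * (4 * |x - y| ^ α)) := by
        rw [norm_mul, norm_mul]
        gcongr
        · exact hk x hx'
        · exact hub y γ hγ3
        · exact e3.trans (by gcongr)
    _ ≤ H * |x - y| ^ α := by
        have : 0 ≤ C₀ * L * |x - y| ^ α := by positivity
        rw [hH]; nlinarith

/-! ### Assembling the stability estimate -/

/-- The gauged weight is close to its value at the base point. -/
theorem norm_gauged_sub_le {u : ℝ → ℝ → ℂ} {m : ℝ → ℝ → ℝ → ℂ} {J : ℕ → ℝ → ℝ → ℂ}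
    {C₀ α γ L q h : ℝ} (hC₀ : 0 ≤ C₀) (hα : 0 < α) (hα1 : α ≤ 1) (hL0 : 0 ≤ L) (hq0 : 0 ≤ q)
    (hγ0 : 0 < γ) (hγ : γ < 1) (h0 : 0 < h) (hhγ : h ≤ γ)
    (hHol : ∀ x y x' y', ‖u x y - u x' y'‖ ≤ C₀ * (|x - x'| + |y - y'|) ^ α)
    (hsupp : ∀ x y, y < x ^ 2 → u x y = 0)
    (hL : ∀ x ∈ Set.Icc (-2 : ℝ) 2, ∀ ξ ∈ Set.Icc (-1 : ℝ) 1,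
      ∀ η ∈ Set.Icc (-1 : ℝ) 1, ‖m x ξ η‖ ≤ L ∧
      ∀ x' ∈ Set.Icc (-2 : ℝ) 2, ∀ ξ' ∈ Set.Icc (-1 : ℝ) 1, ∀ η' ∈ Set.Icc (-1 : ℝ) 1,
        ‖m x ξ η - m x' ξ' η'‖ ≤ L * (|x - x'| + |ξ - ξ'| + |η - η'|))
    (hjet : ∀ ξ ∈ Set.Icc (-1 : ℝ) 1, ∀ η ∈ Set.Icc (-γ) γ,
      ‖jetInt γ J 0 ξ η‖ ≤ q * |η - γ|)
    {x ξ η : ℝ} (hx : x ∈ Set.Icc (-2 : ℝ) 2) (hξ : ξ ∈ Set.Icc (-h) h)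
    (hη : η ∈ Set.Icc (γ - h) γ) :
    ‖u x (ξ * x + η) * (m x ξ η * Complex.exp (jetInt γ J 0 ξ η)) - u x γ * m x 0 γ‖
      ≤ C₀ * Real.exp q * (3 * L + 8 * L + 4 * L * q) * h ^ α := by
  have hub := norm_le_of_holder_of_support hC₀ hα hα1 hHol hsupp
  have hγ3 : |γ| ≤ 3 := by rw [abs_of_pos hγ0]; linarith
  have hγm : γ ∈ Set.Icc (-1 : ℝ) 1 := ⟨by linarith, hγ.le⟩
  have h0m : (0 : ℝ) ∈ Set.Icc (-1 : ℝ) 1 := by norm_num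
  have hh1 : h ≤ 1 := hhγ.trans hγ.le
  have hhα : h ≤ h ^ α := by
    simpa using le_mul_rpow hα hα1 le_rfl h0.le hh1
  have hξ1 : ξ ∈ Set.Icc (-1 : ℝ) 1 := ⟨by linarith [hξ.1], by linarith [hξ.2]⟩
  have hηγ : η ∈ Set.Icc (-γ) γ := ⟨by linarith [hη.1], hη.2⟩
  have hη1 : η ∈ Set.Icc (-1 : ℝ) 1 := ⟨by linarith [hη.1], by linarith [hη.2]⟩
  have hξh : |ξ| ≤ h := abs_le.mpr hξ
  have hηh : |η - γ| ≤ h := abs_le.mpr ⟨by linarith [hη.1], by linarith [hη.2]⟩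
  have hx2 : |x| ≤ 2 := abs_le.mpr hx
  have hjA : ‖jetInt γ J 0 ξ η‖ ≤ q * h := (hjet ξ hξ1 η hηγ).trans (by gcongr)
  have hjA1 : ‖jetInt γ J 0 ξ η‖ ≤ q := hjA.trans (by nlinarith)
  have hexp : ‖Complex.exp (jetInt γ J 0 ξ η)‖ ≤ Real.exp q :=
    (Complex.norm_exp_le_exp_norm _).trans (Real.exp_le_exp.mpr hjA1)
  have hexp1 : ‖Complex.exp (jetInt γ J 0 ξ η) - 1‖ ≤ q * h * Real.exp q :=
    (norm_exp_sub_one_le_mul_exp _).trans (by gcongr)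
  have hu1 : ‖u x (ξ * x + η) - u x γ‖ ≤ C₀ * (3 * h ^ α) := by
    have e1 := hHol x (ξ * x + η) x γ
    rw [sub_self, abs_zero, zero_add] at e1
    have e2 : |ξ * x + η - γ| ≤ 3 * h := by
      calc |ξ * x + η - γ| = |ξ * x + (η - γ)| := by ring_nf
        _ ≤ |ξ| * |x| + |η - γ| := by rw [← abs_mul]; exact abs_add_le _ _
        _ ≤ h * 2 + h := by gcongr
        _ = _ := by ring
    have e3 : |ξ * x + η - γ| ^ α ≤ 3 * h ^ α := by
      calc |ξ * x + η - γ| ^ α ≤ (3 * h) ^ α := by gcongr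
        _ = 3 ^ α * h ^ α := Real.mul_rpow (by norm_num) h0.le
        _ ≤ 3 ^ (1 : ℝ) * h ^ α := by
          gcongr
          norm_num
        _ = _ := by rw [Real.rpow_one]
    exact e1.trans (by gcongr)
  have hm1 : ‖m x ξ η - m x 0 γ‖ ≤ L * (2 * h) := by
    have e1 := (hL x hx ξ hξ1 η hη1).2 x hx 0 h0m γ hγm
    rw [sub_self, abs_zero, zero_add, sub_zero] at e1
    exact e1.trans (by gcongr; linarith)
  -- Replace in turn `u`, the weight and the gauge factor by their values at `(0, γ)`; the gauge
  -- equals 1 on `η = γ`. The three errors give `3 L`, `8 L` and `4 L q`.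
  have e : u x (ξ * x + η) * (m x ξ η * Complex.exp (jetInt γ J 0 ξ η)) - u x γ * m x 0 γ
      = (u x (ξ * x + η) - u x γ) * (m x ξ η * Complex.exp (jetInt γ J 0 ξ η))
        + u x γ * ((m x ξ η - m x 0 γ) * Complex.exp (jetInt γ J 0 ξ η))
        + u x γ * (m x 0 γ * (Complex.exp (jetInt γ J 0 ξ η) - 1)) := by
    ring
  rw [e]
  refine norm_add₃_le.trans ?_
  simp only [norm_mul]
  calc _ ≤ C₀ * (3 * h ^ α) * (L * Real.exp q) + 4 * C₀ * (L * (2 * h) * Real.exp q)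
        + 4 * C₀ * (L * (q * h * Real.exp q)) := by
        gcongr
        · exact (hL x hx ξ hξ1 η hη1).1
        · exact hub x γ hγ3
        · exact hub x γ hγ3
        · exact (hL x hx 0 h0m γ hγm).1
    _ ≤ C₀ * (3 * h ^ α) * (L * Real.exp q) + 4 * C₀ * (L * (2 * h ^ α) * Real.exp q)
        + 4 * C₀ * (L * (q * h ^ α * Real.exp q)) := by gcongr
    _ = _ := by ring

/-- The moments of the slice averages are controlled by the data on a rectangle. -/
theorem norm_moment_sliceAvg_le {a b : ℝ → ℝ → ℂ} {m : ℝ → ℝ → ℝ → ℂ} (hm : IsWeight a b m)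
    {u : ℝ → ℝ → ℂ} {I J F : ℕ → ℝ → ℝ → ℂ} {ε γ q h D r : ℝ} {n s : ℕ}
    (hu : Continuous fun p : ℝ × ℝ => u p.1 p.2) (hsupp : ∀ x y, y < x ^ 2 → u x y = 0)
    (hI : IsJet I) (hIb : I 0 = b) (hJ : IsJet J) (hJa : J 0 = a) (hF : IsJet F)
    (hFγ : ∀ i ξ η, γ ≤ η → F i ξ η = 0) (hFl : ∀ i < 2 * n, ∀ η, F i (-h) η = 0)
    (hFr : ∀ i < 2 * n, ∀ η, F i h η = 0)
    (hFb : ∀ i ≤ 2 * n, ∀ ξ ∈ Set.Icc (-h) h, ∀ η,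
        ‖F i ξ η‖ ≤ 3 / h ^ 2 * 6 ^ (2 * n) * ((2 * n : ℕ) / h) ^ i)
    (hh : h = 1 / n) (hn2 : 2 ≤ n) (hhε : h ≤ ε) (hhγ : h ≤ γ) (hγ : γ < 1) (hq0 : 0 ≤ q)
    (hD : 0 < D) (hr : 0 ≤ r)
    (hDb : ∀ n : ℕ, ∀ i ≤ n, ∀ ξ ∈ Set.Icc (-1 : ℝ) 1, ∀ η ∈ Set.Icc (-γ) γ,
      ‖I i ξ η + jetInt γ J (i + 1) ξ η‖ ≤ D * (D * ((n : ℝ) + 1) ^ s) ^ i)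
    (hjet : ∀ ξ ∈ Set.Icc (-1 : ℝ) 1, ∀ η ∈ Set.Icc (-γ) γ,
      ‖jetInt γ J 0 ξ η‖ ≤ q * |η - γ|)
    (hrect : rectL1 ε γ (fun ξ η => ∫ x, u x (ξ * x + η) * m x ξ η) ≤ ENNReal.ofReal r)
    (k : ℕ) (hk : k < n) :
    ‖∫ x in (-2 : ℝ)..2, (x : ℂ) ^ k *
        sliceAvg u (fun x ξ η => m x ξ η * Complex.exp (jetInt γ J 0 ξ η)) h (F 0) x‖
      ≤ (Real.exp (2 * q) * (3 * (n : ℝ) ^ 2 * 6 ^ (2 * n) *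
        (2 * (2 * (n : ℝ) ^ 2 + n * (D * ((n : ℝ) + 1) ^ s) + D)) ^ n)) * r := by
  have hnR : (2 : ℝ) ≤ n := by exact_mod_cast hn2
  have hnpos : (0 : ℝ) < n := by linarith
  have h0 : 0 < h := by rw [hh]; positivity
  have hh1 : h ≤ 1 := hhγ.trans hγ.le
  set w : ℝ → ℝ → ℝ → ℂ := fun x ξ η => m x ξ η * Complex.exp (jetInt γ J 0 ξ η) with hw
  set β : ℕ → ℝ → ℝ → ℂ := fun i ξ η => I i ξ η + jetInt γ J (i + 1) ξ η with hβdef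
  have hβ : IsJet β := hI.add (hJ.int γ).shift
  have hEc : Continuous fun p : ℝ × ℝ => Complex.exp (jetInt γ J 0 p.1 p.2) :=
    ((hJ.int γ).continuous 0).cexp
  have hmc := hm.smooth.continuous
  have hwc : Continuous fun p : ℝ × ℝ × ℝ => w p.1 p.2.1 p.2.2 :=
    hmc.mul (hEc.comp continuous_snd)
  have e1 : ∫ x in (-2 : ℝ)..2, (x : ℂ) ^ k * sliceAvg u w h (F 0) x
      = ∫ x in (-2 : ℝ)..2, sliceAvg u w h ((jetStep γ β)^[k] F 0) x := by
    refine intervalIntegral.integral_congr fun x hx => ?_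
    rw [Set.uIcc_of_le (by norm_num)] at hx
    refine pow_mul_sliceAvg (r := 2 * n) hu hsupp hwc hβ (fun y ξ => ?_) hF hFγ hFl hFr h0 hh1
      hγ (abs_le.mpr hx) k (by omega)
    simp only [hβdef, hIb, hw]
    exact hm.hasDerivAt_gauge hJ hJa γ x y ξ
  have hbd : ∀ ξ ∈ Set.Icc (-h) h, ∀ η ∈ Set.Icc (-γ) γ,
      ‖Complex.exp (jetInt γ J 0 ξ η) * (jetStep γ β)^[k] F 0 ξ η‖
        ≤ Real.exp (2 * q) * (3 * (n : ℝ) ^ 2 * 6 ^ (2 * n) *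
      (2 * (2 * (n : ℝ) ^ 2 + n * (D * ((n : ℝ) + 1) ^ s) + D)) ^ n) := by
    intro ξ hξ η hη
    have hξ1 : ξ ∈ Set.Icc (-1 : ℝ) 1 := ⟨by linarith [hξ.1], by linarith [hξ.2]⟩
    have f1 : ‖Complex.exp (jetInt γ J 0 ξ η)‖ ≤ Real.exp (2 * q) := by
      refine (Complex.norm_exp_le_exp_norm _).trans (Real.exp_le_exp.mpr ?_)
      have : |η - γ| ≤ 2 := abs_le.mpr ⟨by linarith [hη.1], by linarith [hη.2]⟩
      calc _ ≤ q * |η - γ| := hjet ξ hξ1 η hη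
        _ ≤ q * 2 := by gcongr
        _ = _ := mul_comm _ _
    -- With `h = 1/n` the ratio `2n / h` of the bump becomes `2 n²`, and its prefactor `3 / h²`
    -- becomes `3 n²`.
    have f2 := norm_jetStep_iterate_le (β := β) (F := F) (γ := γ) (D := D)
      (l₀ := D * ((n : ℝ) + 1) ^ s) (Λ := 2 * (n : ℝ) ^ 2)
      (Q := 3 * (n : ℝ) ^ 2 * 6 ^ (2 * n)) (n := n) (S := Set.Icc (-h) h) hγ.le hD.le
      (by positivity) (by positivity) (by positivity)
      (fun i hi ξ hξ η hη => hDb n i hi ξ ⟨by linarith [hξ.1], by linarith [hξ.2]⟩ η hη)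
      (fun i hi ξ hξ η _ => by
        have := hFb i (by omega) ξ hξ η
        have f3 : 3 / h ^ 2 = 3 * (n : ℝ) ^ 2 := by rw [hh]; field_simp
        have f4 : ((2 * n : ℕ) : ℝ) / h = 2 * (n : ℝ) ^ 2 := by
          rw [hh]; push_cast; field_simp
        rwa [f3, f4] at this) k 0 (by omega) ξ hξ η hη
    rw [pow_zero, mul_one] at f2
    rw [norm_mul]
    gcongr
    refine f2.trans ?_
    gcongr
    · have : 0 ≤ (n : ℝ) * (D * ((n : ℝ) + 1) ^ s) := by positivity
      nlinarith
  have e2 := enorm_integral_sliceAvg_le (E := fun ξ η => Complex.exp (jetInt γ J 0 ξ η))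
    hu hsupp hmc hEc ((hβ.step_iterate hF γ k).continuous 0)
    (continuous_lineIntegral hu hsupp hmc) (fun _ _ => rfl)
    (jetStep_iterate_eq_zero_of_ge hFγ k 0) hbd h0 hhε hhγ hγ
  rw [e1]
  have e3 := e2.trans (mul_le_mul_right hrect _)
  rw [← ENNReal.ofReal_mul (by positivity), ← ofReal_norm] at e3
  exact (ENNReal.ofReal_le_ofReal_iff (by positivity)).mp e3

/-- The quantitative estimate: a line restriction is controlled by the data on a rectangle, up to
an error decreasing with the number of moments used. -/
theorem exists_stability_estimate {σ : ℝ} (hσ : 1 ≤ σ) {C₀ α : ℝ} (hC₀ : 0 ≤ C₀) (hα : 0 < α)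
    (hα1 : α ≤ 1) {a b : ℝ → ℝ → ℂ} {m : ℝ → ℝ → ℝ → ℂ} (ha : IsGevrey σ a) (hb : IsGevrey σ b)
    (hm : IsWeight a b m) {ε γ : ℝ} (hε : 0 < ε) (hγ0 : 0 < γ) (hγ : γ < 1) :
    ∃ A : ℝ, 0 < A ∧ ∃ P n₀ : ℕ, ∀ u : ℝ → ℝ → ℂ, Continuous (fun p : ℝ × ℝ => u p.1 p.2) →
      (∀ x y x' y', ‖u x y - u x' y'‖ ≤ C₀ * (|x - x'| + |y - y'|) ^ α) →
      (∀ x y, y < x ^ 2 → u x y = 0) →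
      ∀ r : ℝ, 0 ≤ r →
        rectL1 ε γ (fun ξ η => ∫ x, u x (ξ * x + η) * m x ξ η) ≤ ENNReal.ofReal r →
        ∀ n : ℕ, n₀ ≤ n → ∀ x,
          ‖u x γ * m x 0 γ‖ ≤ A * (n : ℝ) ^ (-α) + (n : ℝ) ^ (P * n) * r := by
  obtain ⟨J, hJ, hJa, hJK⟩ := ha.exists_isJet
  obtain ⟨I, hI, hIb, hIK⟩ := hb.exists_isJet
  obtain ⟨s, hs⟩ := exists_nat_ge σ
  obtain ⟨D, hD, hDb⟩ := exists_gauge_bounds (by linarith) hs hγ.le hIK hJK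
  obtain ⟨L, hL0, hL⟩ := exists_lipschitz_bound hm.smooth
  obtain ⟨A₀, hA₀, hsmooth⟩ := exists_norm_le_of_moments
  obtain ⟨q, hq⟩ : ∃ q : ℝ, ∀ ξ ∈ Set.Icc (-1 : ℝ) 1, ∀ η ∈ Set.Icc (-1 : ℝ) 1, ‖J 0 ξ η‖ ≤ q := by
    obtain ⟨q, hq⟩ := ((isCompact_Icc (a := (-1 : ℝ)) (b := 1)).prod
      (isCompact_Icc (a := (-1 : ℝ)) (b := 1))).exists_bound_of_continuousOn
      (hJ.continuous 0).continuousOn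
    exact ⟨q, fun ξ hξ η hη => hq (ξ, η) ⟨hξ, hη⟩⟩
  have hq0 : 0 ≤ q := (norm_nonneg _).trans (hq 0 (by norm_num) 0 (by norm_num))
  have hjet : ∀ ξ ∈ Set.Icc (-1 : ℝ) 1, ∀ η ∈ Set.Icc (-γ) γ,
      ‖jetInt γ J 0 ξ η‖ ≤ q * |η - γ| := fun ξ hξ η hη =>
    intervalIntegral.norm_integral_le_of_norm_le_const fun t ht => hq ξ hξ t (by
      rw [Set.uIoc_of_ge hη.2] at ht
      exact ⟨by linarith [hη.1, ht.1], by linarith [ht.2]⟩)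
  obtain ⟨P, hP⟩ := exists_const_le_pow A₀ D (Real.exp (2 * q)) hA₀.le hD.le
    (Real.exp_nonneg _) s
  set A₁ := C₀ * Real.exp q * (3 * L + 8 * L + 4 * L * q) with hA₁
  set H := 5 * C₀ * L + 16 * C₀ * L with hH
  set B := A₁ + 4 * C₀ * L with hB
  have hA₁0 : 0 ≤ A₁ := by positivity
  have hB0 : 0 ≤ B := by positivity
  -- Beyond `n₁` the width `1/n` is at most `ε` and `γ`, so the bump fits in the rectangle where the
  -- data are measured.
  obtain ⟨n₁, hn₁⟩ := exists_nat_ge (1 / min ε γ)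
  -- `H` comes from mollification, `A₁` from averaging, and `32 B = 8 B · 4` from the Taylor tail.
  -- The final 1 keeps the constant positive when `C₀ = 0`.
  refine ⟨A₀ * (H + A₁ + 32 * B) + 1, by positivity, P, max 2 n₁, ?_⟩
  intro u hu hHol hsupp r hr hrect n hn x
  have hn2 : 2 ≤ n := (le_max_left _ _).trans hn
  have hn0 : 0 < n := by omega
  have hnR : (2 : ℝ) ≤ n := by exact_mod_cast hn2
  have hnpos : (0 : ℝ) < n := by linarith
  set h : ℝ := 1 / n with hh
  have h0 : 0 < h := by positivity
  have hmin : 0 < min ε γ := lt_min hε hγ0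
  have hhle : h ≤ min ε γ := by
    have : 1 / min ε γ ≤ n := hn₁.trans (by exact_mod_cast (le_max_right _ _).trans hn)
    rw [hh, div_le_iff₀ hnpos]
    rwa [div_le_iff₀ hmin, mul_comm] at this
  have hhε : h ≤ ε := hhle.trans (min_le_left _ _)
  have hhγ : h ≤ γ := hhle.trans (min_le_right _ _)
  have hh1 : h ≤ 1 := hhγ.trans hγ.le
  have hhn : h ^ α = (n : ℝ) ^ (-α) := by
    rw [hh, one_div, Real.inv_rpow hnpos.le, Real.rpow_neg hnpos.le]
  obtain ⟨F, p, hF, hFγ, hFl, hFr, hFb, hFp, hp0, hpz, hpc, hpi⟩ := exists_bump_isJet n h0 hhγ hγ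
  set w : ℝ → ℝ → ℝ → ℂ := fun x ξ η => m x ξ η * Complex.exp (jetInt γ J 0 ξ η) with hw
  have hEc : Continuous fun p : ℝ × ℝ => Complex.exp (jetInt γ J 0 p.1 p.2) :=
    ((hJ.int γ).continuous 0).cexp
  have hmc := hm.smooth.continuous
  have hwc : Continuous fun p : ℝ × ℝ × ℝ => w p.1 p.2.1 p.2.2 :=
    hmc.mul (hEc.comp continuous_snd)
  have hγm : γ ∈ Set.Icc (-1 : ℝ) 1 := ⟨by linarith, hγ.le⟩
  have h0m : (0 : ℝ) ∈ Set.Icc (-1 : ℝ) 1 := by norm_num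
  set g : ℝ → ℂ := fun x => u x γ * m x 0 γ with hg
  obtain ⟨hgz, hgb, hgH⟩ := holder_mul_of_support (k := fun x => m x 0 γ) hC₀ hα hα1 hL0 hγ0 hγ
    hHol hsupp (fun x hx => (hL x hx 0 h0m γ hγm).1) (fun x hx y hy => by
      simpa using (hL x hx 0 h0m γ hγm).2 y hy 0 h0m γ hγm)
  have hGδ : ∀ x ∈ Set.Icc (-2 : ℝ) 2, ‖sliceAvg u w h (F 0) x - g x‖ ≤ A₁ * h ^ α := by
    intro x hx
    refine norm_sliceAvg_sub_le hu hwc h0 hFp hp0 hpz hpc hpi fun ξ hξ η hη =>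
      norm_gauged_sub_le hC₀ hα hα1 hL0 hq0 hγ0 hγ h0 hhγ hHol hsupp hL hjet hx hξ hη
  have hmom := norm_moment_sliceAvg_le hm hu hsupp hI hIb hJ hJa hF hFγ hFl hFr hFb hh hn2 hhε
    hhγ hγ hq0 hD hr hDb hjet hrect
  have hhα1 : h ^ α ≤ 1 := Real.rpow_le_one h0.le hh1 hα.le
  have hgc : Continuous g :=
    (hu.comp (by fun_prop : Continuous fun x : ℝ => (x, γ))).mul
      (hmc.comp (by fun_prop : Continuous fun x : ℝ => (x, (0 : ℝ), γ)))
  have hmain := hsmooth (α := α) (H := H) (B := B) (δ := A₁ * h ^ α) (n := n) hα.le hα1 hn0 hgc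
    (continuous_sliceAvg hu hwc (hF.continuous 0)) hgH (fun x hx => hgz x (by
      by_contra hcon
      have := abs_lt.mp (not_le.mp hcon)
      exact hx ⟨by linarith, by linarith⟩))
    (fun x hx => by
      have := norm_le_norm_add_norm_sub (g x) (sliceAvg u w h (F 0) x)
      rw [norm_sub_rev] at this
      have := hGδ x hx
      have := hgb x hx
      have : A₁ * h ^ α ≤ A₁ := by nlinarith
      rw [hB]; linarith)
    (fun x hx => by rw [norm_sub_rev]; exact hGδ x hx) hmom x
  have hP' := mul_le_mul_of_nonneg_right (hP n hn2) hr
  have hhalf := nat_mul_half_pow_le hα1 hn0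
  have hnα : 0 ≤ (n : ℝ) ^ (-α) := by positivity
  rw [hhn] at hmain
  refine hmain.trans ?_
  set X := Real.exp (2 * q) * (3 * (n : ℝ) ^ 2 * 6 ^ (2 * n) *
        (2 * (2 * (n : ℝ) ^ 2 + n * (D * ((n : ℝ) + 1) ^ s) + D)) ^ n) with hX
  calc _ = A₀ * (H + A₁) * (n : ℝ) ^ (-α) + A₀ * (8 * B * (n * (1 / 2) ^ n))
        + A₀ * (n * (Real.exp n * X)) * r := by ring
    _ ≤ A₀ * (H + A₁) * (n : ℝ) ^ (-α) + A₀ * (8 * B * (4 * (n : ℝ) ^ (-α)))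
        + (n : ℝ) ^ (P * n) * r := by gcongr
    _ ≤ _ := by nlinarith

/-! ### Choice of the number of moments, and conclusion -/

open Filter in
/-- The choice of the number of moments. -/
theorem exists_optimal_nat {A α c : ℝ} (hA : 0 < A) (hα : 0 < α) (hα1 : α ≤ 1) (hc : 0 < c)
    (P n₀ : ℕ) : ∃ L₀ : ℝ, ∀ L : ℝ, L₀ < L → ∃ n : ℕ, n₀ ≤ n ∧
      2 * (A * (n : ℝ) ^ (-α) + (n : ℝ) ^ (P * n) * (Real.exp (-L) / c))
        ≤ (Real.log L ^ 2 / L) ^ α := by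
  -- Chosen so that `A X^(-α)`, for `X = K L / (log L)²`, is exactly a quarter of the target. The
  -- second logarithm in `X` is what lets `K` be arbitrarily large.
  set K : ℝ := (4 * A) ^ (1 / α) with hK
  have hK0 : 0 < K := by positivity
  have hlog := Real.tendsto_log_atTop
  have hdiv : Tendsto (fun L : ℝ => Real.log L ^ 2 / L) atTop (nhds 0) :=
    Real.isLittleO_pow_log_id_atTop.tendsto_div_nhds_zero
  have hexp : Tendsto (fun L : ℝ => L * Real.exp (-(1 / 2) * L)) atTop (nhds 0) := by
    simpa using tendsto_rpow_mul_exp_neg_mul_atTop_nhds_zero 1 (1 / 2) (by norm_num)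
  -- In order of use below: `2K ≤ log L` gives `n ≤ L`; `4PK ≤ log L` gives `n^(P n) ≤ exp (L/2)`;
  -- the third smallness condition gives `n ≥ n₀`; the next absorbs `1/c` in the data term.
  have hev : ∀ᶠ L : ℝ in atTop, 1 ≤ Real.log L ∧ 2 * K ≤ Real.log L ∧
      4 * P * K ≤ Real.log L ∧ Real.log L ^ 2 / L < K / (n₀ + 1) ∧
      L * Real.exp (-(1 / 2) * L) < c / 4 ∧ 1 ≤ L :=
    (hlog.eventually_ge_atTop _).and ((hlog.eventually_ge_atTop _).and
      ((hlog.eventually_ge_atTop _).and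
        ((hdiv.eventually_lt_const (by positivity)).and
          ((hexp.eventually_lt_const (by positivity)).and (eventually_ge_atTop 1)))))
  obtain ⟨L₀, hL₀⟩ := eventually_atTop.mp hev
  refine ⟨L₀, fun L hL => ?_⟩
  obtain ⟨h1, h2, h3, h4, h5, h6⟩ := hL₀ L hL.le
  set l := Real.log L with hl
  have hL0 : 0 < L := by linarith
  have hl0 : 0 < l := by linarith
  set X : ℝ := K * L / l ^ 2 with hX
  have hXn : (n₀ : ℝ) + 1 < X := by
    rw [div_lt_div_iff₀ hL0 (by positivity)] at h4
    rw [hX, lt_div_iff₀ (by positivity)]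
    linarith
  have hX1 : 1 ≤ X := by linarith [show (0 : ℝ) ≤ n₀ by positivity]
  set n := ⌈X⌉₊ with hn
  have hnX : X ≤ n := Nat.le_ceil X
  have hnX2 : (n : ℝ) ≤ 2 * X := by
    have := (Nat.ceil_lt_add_one (by linarith : 0 ≤ X)).le
    linarith
  have hn0 : (0 : ℝ) < n := by linarith
  refine ⟨n, ?_, ?_⟩
  · have : (n₀ : ℝ) ≤ n := by linarith
    exact_mod_cast this
  have hnL : (n : ℝ) ≤ L := by
    refine hnX2.trans ?_
    rw [hX, ← mul_div_assoc, div_le_iff₀ (by positivity)]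
    have h7 : l ≤ l ^ 2 := by nlinarith
    calc 2 * (K * L) = (2 * K) * L := by ring
      _ ≤ l ^ 2 * L := by gcongr; linarith
      _ = _ := mul_comm _ _
  have hlogn : Real.log n ≤ l := Real.log_le_log hn0 hnL
  have hY : 0 < (l ^ 2 / L) ^ α := by positivity
  have e1 : A * (n : ℝ) ^ (-α) ≤ (l ^ 2 / L) ^ α / 4 := by
    calc A * (n : ℝ) ^ (-α) ≤ A * X ^ (-α) := by
          gcongr ?_ * ?_
          exact Real.rpow_le_rpow_of_nonpos (by linarith) hnX (by linarith)
      _ = A * (K ^ (-α) * (l ^ 2 / L) ^ α) := by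
          rw [Real.rpow_neg (by linarith), ← Real.inv_rpow (by linarith), Real.rpow_neg hK0.le,
            ← Real.inv_rpow hK0.le, ← Real.mul_rpow (by positivity) (by positivity)]
          congr 2
          rw [hX]; field_simp
      _ = _ := by
          rw [Real.rpow_neg hK0.le, hK, ← Real.rpow_mul (by positivity), one_div_mul_cancel hα.ne',
            Real.rpow_one]
          field_simp
  have e2 : (n : ℝ) ^ (P * n) * (Real.exp (-L) / c) ≤ (l ^ 2 / L) ^ α / 4 := by
    have f1 : (n : ℝ) ^ (P * n) ≤ Real.exp (L / 2) := by
      rw [← Real.log_le_iff_le_exp (by positivity), Real.log_pow]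
      push_cast
      -- As `n ≤ 2X` and `log n ≤ l`, one of the two logarithms in `X` is spent on `log n` and the
      -- other beats the constant `4 P K`.
      calc (P : ℝ) * n * Real.log n ≤ P * (2 * X) * l := by gcongr
        _ = 2 * P * K / l * L := by rw [hX]; field_simp
        _ ≤ 1 / 2 * L := by
          refine mul_le_mul_of_nonneg_right ?_ hL0.le
          rw [div_le_iff₀ hl0]; linarith
        _ = L / 2 := by ring
    have f2 : L⁻¹ ≤ (l ^ 2 / L) ^ α := by
      calc L⁻¹ = (1 / L) ^ (1 : ℝ) := by simp
        _ ≤ (1 / L) ^ α := Real.rpow_le_rpow_of_exponent_ge (by positivity)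
            (by rw [div_le_one hL0]; exact h6) hα1
        _ ≤ _ := by gcongr; nlinarith
    calc _ ≤ Real.exp (L / 2) * (Real.exp (-L) / c) := by gcongr
      _ = (L * Real.exp (-(1 / 2) * L)) * L⁻¹ / c := by
          rw [← mul_div_assoc, ← Real.exp_add]
          field_simp
          congr 1; ring
      _ ≤ c / 4 * L⁻¹ / c := by gcongr
      _ = L⁻¹ / 4 := by field_simp
      _ ≤ _ := by gcongr
  linarith

/-- The support has length at most 2, and `√2` is rounded up to 2; this is the factor 2 in
`exists_optimal_nat`. -/
theorem eLpNorm_two_le_of_support {g : ℝ → ℂ} {B : ℝ} (hg : ∀ x, ‖g x‖ ≤ B)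
    (hz : ∀ x, 1 ≤ |x| → g x = 0) : eLpNorm g 2 volume ≤ ENNReal.ofReal (2 * B) := by
  have hB : 0 ≤ B := (norm_nonneg _).trans (hg 0)
  have h1 : eLpNorm g 2 volume
      ≤ eLpNorm ((Set.Icc (-1 : ℝ) 1).indicator fun _ => B) 2 volume := by
    refine eLpNorm_mono_real fun x => ?_
    by_cases hx : x ∈ Set.Icc (-1 : ℝ) 1
    · rw [Set.indicator_of_mem hx]; exact hg x
    · rw [Set.indicator_of_notMem hx, hz x, norm_zero]
      by_contra hcon
      exact hx ⟨(abs_lt.mp (not_le.mp hcon)).1.le, (abs_lt.mp (not_le.mp hcon)).2.le⟩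
  refine h1.trans ?_
  rw [eLpNorm_indicator_const measurableSet_Icc (by norm_num) (by norm_num), Real.volume_Icc,
    mul_comm (2 : ℝ) B, ENNReal.ofReal_mul hB, ← ofReal_norm, Real.norm_of_nonneg hB,
    show (1 : ℝ) - -1 = 2 by norm_num]
  gcongr
  calc ENNReal.ofReal 2 ^ (1 / (2 : ℝ≥0∞).toReal) ≤ ENNReal.ofReal 2 ^ (1 : ℝ) :=
        ENNReal.rpow_le_rpow_of_exponent_le (by norm_num) (by norm_num)
    _ = _ := ENNReal.rpow_one _

/-- The properties of a Hölder function on the plane supported above the parabola, in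
coordinates. -/
theorem coordinates_of_holderWith {f : EuclideanSpace ℝ (Fin 2) → ℂ} {C₀ α : ℝ≥0} (hα : 0 < α)
    (hf : HolderWith C₀ α f) (hs : tsupport f ⊆ {p | p 0 ^ 2 ≤ p 1}) :
    Continuous (fun p : ℝ × ℝ => f !₂[p.1, p.2]) ∧
      (∀ x y x' y', ‖f !₂[x, y] - f !₂[x', y']‖ ≤ C₀ * (|x - x'| + |y - y'|) ^ (α : ℝ)) ∧
      ∀ x y, y < x ^ 2 → f !₂[x, y] = 0 := by
  refine ⟨(hf.continuous hα).comp ?_, fun x y x' y' => ?_, fun x y hxy => ?_⟩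
  · refine (PiLp.continuous_toLp 2 _).comp (continuous_pi fun i => ?_)
    fin_cases i
    · exact continuous_fst
    · exact continuous_snd
  · have hd : dist (!₂[x, y] : EuclideanSpace ℝ (Fin 2)) (!₂[x', y']) ≤ |x - x'| + |y - y'| := by
      rw [EuclideanSpace.dist_eq, Fin.sum_univ_two, Real.sqrt_le_left (by positivity)]
      simp only [Real.dist_eq, sq_abs, Matrix.cons_val_zero, Matrix.cons_val_one]
      nlinarith [abs_nonneg (x - x'), abs_nonneg (y - y'), sq_abs (x - x'), sq_abs (y - y'),
        mul_nonneg (abs_nonneg (x - x')) (abs_nonneg (y - y'))]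
    rw [← dist_eq_norm]
    exact (hf.dist_le _ _).trans (by gcongr)
  · by_contra hne
    have := hs (subset_tsupport f hne)
    simp only [Set.mem_ofPred_eq, Matrix.cons_val_zero, Matrix.cons_val_one] at this
    linarith

open Filter in
/-- Vanishing data on a rectangle force the line restriction to vanish. -/
theorem eq_zero_of_forall_le {A α z : ℝ} {n₀ : ℕ} (hα : 0 < α) (hz : 0 ≤ z)
    (h : ∀ n : ℕ, n₀ ≤ n → z ≤ A * (n : ℝ) ^ (-α)) : z = 0 := by
  have h1 : Tendsto (fun n : ℕ => A * (n : ℝ) ^ (-α)) atTop (nhds (A * 0)) :=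
    ((tendsto_rpow_neg_atTop hα).comp tendsto_natCast_atTop_atTop).const_mul A
  rw [mul_zero] at h1
  exact le_antisymm (ge_of_tendsto h1 (eventually_atTop.mpr ⟨n₀, h⟩)) hz

theorem mainTheorem6 (σ : ℝ) (hσ : 1 ≤ σ) (C₀ : ℝ≥0) :
    ∃ M : ℝ, 0 < M ∧
      ∀ (α : ℝ≥0), 0 < α → α ≤ 1 →
      ∀ (a b : ℝ → ℝ → ℂ) (m : ℝ → ℝ → ℝ → ℂ),
        IsGevrey σ a → IsGevrey σ b → IsWeight a b m →
        (∀ N : ℝ → ℝ → (ℝ → ℝ → ℂ) → ℝ≥0∞, ControlsData N →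
          ∀ ε γ : ℝ, 0 < ε → ε < 1 → 0 < γ → γ < 1 →
            ∃ δ : ℝ, 0 < δ ∧
              ∀ f : EuclideanSpace ℝ (Fin 2) → ℂ, HolderWith C₀ α f →
                tsupport f ⊆ {p | p 0 ^ 2 ≤ p 1} →
                  (0 < N ε γ (weightedRadon m f) →
                    N ε γ (weightedRadon m f) < ENNReal.ofReal δ →
                      eLpNorm (fun x : ℝ => f !₂[x, γ] * m x 0 γ) 2 volume ≤
                        ENNReal.ofReal
                          (M * (Real.log (Real.log (1 / (N ε γ (weightedRadon m f)).toReal)) ^ 2 /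
                              Real.log (1 / (N ε γ (weightedRadon m f)).toReal)) ^ (α : ℝ))) ∧
                  (N ε γ (weightedRadon m f) = 0 →
                    eLpNorm (fun x : ℝ => f !₂[x, γ] * m x 0 γ) 2 volume = 0)) ∧
        ((∀ x ξ η : ℝ, m x ξ η ≠ 0) →
          ∀ f : EuclideanSpace ℝ (Fin 2) → ℂ, HolderWith C₀ α f →
            tsupport f ⊆ {p | p 0 ^ 2 ≤ p 1} →
              (∀ᶠ p : ℝ × ℝ in nhds (0, 0), weightedRadon m f p.1 p.2 = 0) →
                ∀ᶠ p in nhds (0 : EuclideanSpace ℝ (Fin 2)), f p = 0) := by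
  -- `M = 1` works: the dependence on the weight, the size, `α`, `ε` and `γ` is moved into `δ`.
  refine ⟨1, one_pos, fun α hα hα1 a b m ha hb hm => ⟨?_, ?_⟩⟩
  · rintro N ⟨c, hc, hN⟩ ε γ hε hε1 hγ0 hγ
    obtain ⟨A, hA, P, n₀, hst⟩ := exists_stability_estimate hσ (C₀ := C₀) (α := α) C₀.2 hα hα1
      ha hb hm hε hγ0 hγ
    obtain ⟨L₀, hL₀⟩ := exists_optimal_nat hA (α := α) (c := c) hα hα1 hc P n₀
    -- Data below `exp (-L₀)` means exactly `log (1/τ) > L₀`.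
    refine ⟨Real.exp (-L₀), Real.exp_pos _, fun f hf hs => ?_⟩
    obtain ⟨hu, hHol, hsupp⟩ := coordinates_of_holderWith hα hf hs
    have hz : ∀ x : ℝ, 1 ≤ |x| → f !₂[x, γ] * m x 0 γ = 0 := fun x hx => by
      rw [hsupp x γ (by rw [← sq_abs]; nlinarith), zero_mul]
    have hrect : (c : ℝ≥0∞) * rectL1 ε γ (weightedRadon m f) ≤ N ε γ (weightedRadon m f) :=
      (mul_le_mul_right (le_max_left _ _) _).trans
        (hN ε γ hε hε1 hγ0 hγ _ (continuous_lineIntegral hu hsupp hm.smooth.continuous))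
    have hc0 : (c : ℝ≥0∞) ≠ 0 := by exact_mod_cast hc.ne'
    have hmain := hst _ hu hHol hsupp
    refine ⟨fun hpos hlt => ?_, fun h0 => ?_⟩
    · set τ := (N ε γ (weightedRadon m f)).toReal with hτ
      have htop : N ε γ (weightedRadon m f) ≠ ⊤ := (hlt.trans ENNReal.ofReal_lt_top).ne
      have hτ0 : 0 < τ := ENNReal.toReal_pos hpos.ne' htop
      have hNτ : N ε γ (weightedRadon m f) = ENNReal.ofReal τ := (ENNReal.ofReal_toReal htop).symm
      have hτlt : τ < Real.exp (-L₀) := by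
        rw [hNτ] at hlt
        exact (ENNReal.ofReal_lt_ofReal_iff (Real.exp_pos _)).mp hlt
      set L := Real.log (1 / τ) with hL
      have hLτ : Real.exp (-L) = τ := by
        rw [hL, one_div, Real.log_inv, neg_neg, Real.exp_log hτ0]
      have hLL : L₀ < L := by
        rw [← hLτ] at hτlt
        linarith [Real.exp_lt_exp.mp hτlt]
      obtain ⟨n, hn, hle⟩ := hL₀ L hLL
      rw [hLτ] at hle
      have hr : rectL1 ε γ (weightedRadon m f) ≤ ENNReal.ofReal (τ / c) := by
        rw [ENNReal.ofReal_div_of_pos (by exact_mod_cast hc), ENNReal.ofReal_coe_nnreal,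
          ENNReal.le_div_iff_mul_le (.inl hc0) (.inl ENNReal.coe_ne_top), mul_comm, ← hNτ]
        exact hrect
      refine (eLpNorm_two_le_of_support (fun x => hmain (τ / c) (by positivity) hr n hn x)
        hz).trans (ENNReal.ofReal_le_ofReal ?_)
      rwa [one_mul]
    · rw [h0, nonpos_iff_eq_zero, mul_eq_zero, or_iff_right hc0] at hrect
      have hg : (fun x : ℝ => f !₂[x, γ] * m x 0 γ) = 0 := by
        funext x
        refine norm_eq_zero.mp (eq_zero_of_forall_le (A := A) (α := α) (n₀ := n₀) hα
          (norm_nonneg _) fun n hn => ?_)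
        simpa using hmain 0 le_rfl (by
          rw [ENNReal.ofReal_zero]; exact hrect.le) n hn x
      rw [hg, eLpNorm_zero]
  · intro hm0 f hf hs hR
    obtain ⟨hu, hHol, hsupp⟩ := coordinates_of_holderWith hα hf hs
    obtain ⟨ρ, hρ, hball⟩ := Metric.eventually_nhds_iff.mp hR
    set ε := min ρ 1 / 2 with hε
    have hε0 : 0 < ε := by positivity
    have hερ : ε < ρ := by linarith [min_le_left ρ 1]
    have hε1 : ε < 1 := by linarith [min_le_right ρ 1]
    -- The estimate is applied with zero data on each height `γ` in `(0, ε)`; letting `n → ∞` kills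
    -- `f m` on that line, and `m` can be divided out.
    have hline : ∀ γ, 0 < γ → γ < ε → ∀ x, f !₂[x, γ] = 0 := fun γ hγ0 hγε x => by
      obtain ⟨A, hA, P, n₀, hst⟩ := exists_stability_estimate hσ (C₀ := C₀) (α := α) C₀.2 hα hα1
        ha hb hm hε0 hγ0 (hγε.trans hε1)
      have hrect : rectL1 ε γ (weightedRadon m f) = 0 := by
        refine (setLIntegral_congr_fun (measurableSet_Icc.prod measurableSet_Ioo)
          fun p hp => ?_).trans lintegral_zero
        have h1 : |p.1| < ρ := (abs_le.mpr hp.1).trans_lt hερ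
        have h2 : |p.2| < ρ := (abs_lt.mpr hp.2).trans (hγε.trans hερ)
        have : weightedRadon m f p.1 p.2 = 0 := hball (by
          rw [Prod.dist_eq, Real.dist_eq, Real.dist_eq, sub_zero, sub_zero]
          exact max_lt h1 h2)
        simp [this]
      have hg : ‖f !₂[x, γ] * m x 0 γ‖ = 0 :=
        eq_zero_of_forall_le (A := A) (α := α) (n₀ := n₀) hα (norm_nonneg _) fun n hn => by
          simpa using hst _ hu hHol hsupp 0 le_rfl (by
            rw [ENNReal.ofReal_zero]; exact hrect.le) n hn x
      exact (mul_eq_zero.mp (norm_eq_zero.mp hg)).resolve_right (hm0 x 0 γ)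
    -- The height `0` is not reached by the estimate, but `f` vanishes at all negative heights and
    -- is continuous.
    have hzero : ∀ x, f !₂[x, 0] = 0 := fun x => by
      have hc : Continuous fun y : ℝ => f !₂[x, y] :=
        hu.comp (by fun_prop : Continuous fun y : ℝ => (x, y))
      refine tendsto_nhds_unique (hc.continuousAt.tendsto.mono_left
        (nhdsWithin_le_nhds (s := Set.Iio 0))) ((Filter.tendsto_congr' ?_).mpr tendsto_const_nhds)
      filter_upwards [self_mem_nhdsWithin] with y hy
      exact hsupp x y (lt_of_lt_of_le hy (sq_nonneg x))
    have hcont : Continuous fun p : EuclideanSpace ℝ (Fin 2) => p 1 := by fun_prop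
    filter_upwards [hcont.continuousAt.eventually_lt continuousAt_const
      (show (0 : EuclideanSpace ℝ (Fin 2)) 1 < ε by simpa using hε0)] with p hp
    have hpe : p = !₂[p 0, p 1] := by
      ext i; fin_cases i <;> simp
    rw [hpe]
    rcases lt_trichotomy (p 1) 0 with h | h | h
    · exact hsupp _ _ (lt_of_lt_of_le h (sq_nonneg _))
    · rw [h]; exact hzero _
    · exact hline _ h hp _
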